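/- For functions $f_1,\dots,f_n:\mathbb R\to\mathbb R$, a probability measure on $\mathbb R^n$ is called the polynomial ensemble with functions $f_1,\dots,f_n$ if the integrals $\int_{-\infty}^{\infty} x^{j-1}f_k(x)\,dx$, $j,k=1,\dots,n$, converge absolutely and the measure has, for some constant $Z_n\neq 0$, the density $$\frac1{Z_n}\,\prod_{j<k}(x_k-x_j)\;\det\big[f_k(x_j)\big]_{j,k=1}^n ,\qquad x\in\mathbb R^n,$$ which is non-negative for all $x\in\mathbb R^n$. Random points $x_1,\dots,x_n$ of $\mathbb R$ form this polynomial ensemble if their joint law is this measure once their ordering is disregarded (that is, after they are labelled in uniformly random order). Functions given on $[0,\infty)$ are extended by $0$ to $\mathbb R$. The squared singular values of a complex matrix $X$ with $n$ columns are the $n$ eigenvalues, with multiplicity, of $X^*X$. **Corollary 5.3.** Let $\nu\ge 0$ be an integer and let $X$ be a random complex $(n+\nu)\times n$ matrix whose squared singular values form a polynomial ensemble with certain functions $f_1,\dots,f_n$ on $[0,\infty)$. Let $v=(v_1,\dots,v_n)^t$ be a random vector, independent of $X$, such that $\operatorname{Re}v_j,\operatorname{Im}v_j$, $j=1,\dots,n$,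 are mutually independent normal random variables with mean $0$ and variance $1/2$, and let $$Y=\begin{pmatrix}X\\ v^*\end{pmatrix}.$$ Then the squared singular values of $Y$ form a polynomial ensemble with the functions $$g_k(y)=\int_0^y e^{-x}f_k(y-x)\,dx,\qquad y\ge 0,\quad k=1,\dots,n,$$ on $[0,\infty)$. -/

import Mathlib

open MeasureTheory ProbabilityTheory
open scoped Nat ENNReal

/-- The function `(1 / Z) * Δ_n(x) * det [f_k(x_j)]` on `ℝ^n`, with the Vandermonde determinant
`Δ_n(x) = ∏_{j < k} (x_k - x_j)`. -/
noncomputable def polynomialEnsembleDensity {n : ℕ} (f : Fin n → ℝ → ℝ) (Z : ℝ)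
    (x : Fin n → ℝ) : ℝ :=
  1 / Z * (∏ j : Fin n, ∏ k ∈ Finset.Ioi j, (x k - x j)) *
    (Matrix.of fun j k : Fin n => f k (x j)).det

/-- The measure `ρ` on `ℝ^n` is the polynomial ensemble with functions `f_1, …, f_n`: it is a
probability measure, the integrals of `x^{j-1} f_k(x)` for `j, k = 1, …, n` converge (absolutely;
this contains the measurability of the functions), and for some normalization constant the function
`(1 / Z) * Δ_n(x) * det [f_k(x_j)]` is non-negative on `ℝ^n` and is the Lebesgue density
of `ρ`. -/
structure IsPolynomialEnsemble {n : ℕ} (ρ : Measure (Fin n → ℝ)) (f : Fin n → ℝ → ℝ) : Prop where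
  isProbabilityMeasure : IsProbabilityMeasure ρ
  integrable_moments : ∀ j k : Fin n, Integrable (fun x : ℝ => x ^ (j : ℕ) * f k x)
  exists_density : ∃ Z : ℝ, Z ≠ 0 ∧ (∀ x, 0 ≤ polynomialEnsembleDensity f Z x) ∧
    ρ = volume.withDensity fun x => ENNReal.ofReal (polynomialEnsembleDensity f Z x)

/-- The law on `ℝ^n` of `n` random real points when their labelling is disregarded: the points
are put in a uniformly random order, independent of everything else. -/
noncomputable def unorderedLaw {Ω : Type*} [MeasurableSpace Ω] {n : ℕ} (P : Measure Ω)
    (x : Ω → Fin n → ℝ) : Measure (Fin n → ℝ) :=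
  ((n ! : ℕ) : ℝ≥0∞)⁻¹ • ∑ σ : Equiv.Perm (Fin n), P.map fun ω j => x ω (σ j)

/-- The squared singular values of `X`: the eigenvalues of `X^* X`, with multiplicity. -/
noncomputable def sqSingularValues {m : Type*} [Fintype m] {n : ℕ}
    (X : Matrix m (Fin n) ℂ) : Fin n → ℝ :=
  (Matrix.isHermitian_conjTranspose_mul_self X).eigenvalues

/-- The real and imaginary parts of the entries of `v` are mutually independent normal random
variables with mean `0` and variance `1/2`. -/
structure IsStandardComplexGaussianVector {Ω : Type*} [MeasurableSpace Ω] {n : ℕ} (P : Measure Ω)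
    (v : Ω → Fin n → ℂ) : Prop where
  hasLaw_re : ∀ j, HasLaw (fun ω => (v ω j).re) (gaussianReal 0 (1 / 2)) P
  hasLaw_im : ∀ j, HasLaw (fun ω => (v ω j).im) (gaussianReal 0 (1 / 2)) P
  indep : iIndepFun
    (Sum.elim (fun (j : Fin n) (ω : Ω) => (v ω j).re) (fun (j : Fin n) (ω : Ω) => (v ω j).im)) P

/-- The matrix `X` with the row `v^*` (the conjugate transpose of `v`) appended. -/
noncomputable def appendRow {m n : ℕ} (X : Matrix (Fin m) (Fin n) ℂ) (v : Fin n → ℂ) :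
    Matrix (Fin m ⊕ Unit) (Fin n) ℂ :=
  Matrix.fromRows X (Matrix.replicateRow Unit (star v))

/-! Appending the row `v^*` replaces `X^*X` by `X^*X + v v^*`. Fix `X` and diagonalise `X^*X = U
diag(x) U^*`. The Gaussian law is unitarily invariant, so `U^*v` has the law of `v`, and the
eigenvalues sought are those of `diag(x) + w w^*` with `w` standard Gaussian
(`sqSingularValues_appendRow`, `map_mulVec_complexGaussian`).

The characteristic polynomial of this matrix, `secular`, depends on `w` only through `a_i =
|w_i|^2`, and the `a_i` are independent exponential variables (`map_normSq_complexGaussian`). For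
strictly increasing `x`, the residue formula `weights x` maps the vectors `y` that interlace with
`x` bijectively onto the positive orthant (`image_weights`, `injOn_weights`). Its Jacobian is `Δ(y)
/ Δ(x)`, a Cauchy determinant (`abs_det_weightsJacobian`), and `∑ a = ∑ y - ∑ x` by comparing traces
(`sum_weights`). Given `x`, the ordered eigenvalues therefore have density `Δ(y) / Δ(x) * exp(∑ x -
∑ y)` on interlacing vectors (`lintegral_perturbedEigenvalues`).

Multiply by the ensemble density of `x` and integrate `x` out: the factor `Δ(x)` cancels. For fixed
`y` the interlacing set is a product of intervals, so the integral of `exp(∑ x) det[f_k(x_j)]` is a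
determinant of one-dimensional integrals; row operations extend each interval down to `-∞`
(`integral_interlaces`). Distributing `exp(-∑ y)` over the rows gives `det[g_k(y_j)]`, with the same
constant `Z` (`lintegral_perturbedExpectation_mul`).

Labels are handled by testing against symmetric functions: integrals against the unordered law
become expectations of symmetrized functions, and integrals of symmetric functions reduce to the
increasing vectors (`lintegral_unorderedLaw`, `lintegral_eq_factorial_mul`). -/

/-! ### Eigenvalues of Hermitian matrices -/

/-- If the monic polynomials with roots `y` and `z` agree and `y` is injective, then `y` is a
permutation of `z`. -/
lemma exists_perm_of_prod_sub_eq {n : ℕ} {y z : Fin n → ℝ} (hy : Function.Injective y)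
    (h : ∀ t : ℝ, ∏ k, (t - y k) = ∏ k, (t - z k)) : ∃ σ : Equiv.Perm (Fin n), y = z ∘ σ := by
  have hex : ∀ i, ∃ j, y i = z j := by
    intro i
    have h0 : ∏ k, (y i - z k) = 0 := by
      rw [← h]; exact Finset.prod_eq_zero (Finset.mem_univ i) (sub_self _)
    obtain ⟨j, -, hj⟩ := Finset.prod_eq_zero_iff.1 h0
    exact ⟨j, sub_eq_zero.1 hj⟩
  choose s hs using hex
  have hinj : Function.Injective s := fun i j hij => hy (by rw [hs, hs, hij])
  exact ⟨Equiv.ofBijective s (Finite.injective_iff_bijective.1 hinj), funext hs⟩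

/-- A polynomial is determined by its values on an infinite set, and sorting fixes the order of its
roots. Evaluating only at naturals keeps the data in a countable product, which the measurability of
eigenvalues needs. -/
lemma antitone_eq_of_prod_sub_eq {m : ℕ} {y z : Fin m → ℝ} (hy : Antitone y) (hz : Antitone z)
    (h : ∀ t : ℕ, ∏ k, ((t : ℝ) - y k) = ∏ k, ((t : ℝ) - z k)) : y = z := by
  have hp : ∏ k, (Polynomial.X - Polynomial.C (y k)) =
      ∏ k, (Polynomial.X - Polynomial.C (z k)) := by
    refine Polynomial.eq_of_infinite_eval_eq _ _ ((Set.infinite_range_of_injective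
      (Nat.cast_injective (R := ℝ))).mono ?_)
    rintro _ ⟨t, rfl⟩
    simpa [Polynomial.eval_prod] using h t
  have hr := congrArg Polynomial.roots hp
  rw [Polynomial.roots_prod _ _ (by simp [Finset.prod_ne_zero_iff, Polynomial.X_sub_C_ne_zero]),
    Polynomial.roots_prod _ _
      (by simp [Finset.prod_ne_zero_iff, Polynomial.X_sub_C_ne_zero])] at hr
  simp only [Polynomial.roots_X_sub_C, Multiset.bind_singleton, Fin.univ_val_map,
    Multiset.coe_eq_coe] at hr
  exact List.ofFn_inj.1 (hr.eq_of_pairwise' hy.sortedGE_ofFn.pairwise hz.sortedGE_ofFn.pairwise)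

namespace Matrix.IsHermitian

variable {n : ℕ} {A : Matrix (Fin n) (Fin n) ℂ}

lemma prod_sub_eigenvalues (hA : A.IsHermitian) (t : ℝ) :
    ((∏ k, (t - hA.eigenvalues k) : ℝ) : ℂ) = (scalar (Fin n) (t : ℂ) - A).det := by
  rw [← Matrix.eval_charpoly, hA.charpoly_eq, Polynomial.eval_prod]
  simp

lemma prod_sub_eigenvalues₀ (hA : A.IsHermitian) (t : ℝ) :
    ((∏ k, (t - hA.eigenvalues₀ k) : ℝ) : ℂ) = (scalar (Fin n) (t : ℂ) - A).det := by
  rw [← hA.prod_sub_eigenvalues, ← Equiv.prod_comp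
    (Fintype.equivOfCardEq (Fintype.card_fin (Fintype.card (Fin n)))).symm]
  rfl

end Matrix.IsHermitian

/-- The eigenvalues of a Hermitian matrix depend measurably on the entries. -/
lemma measurable_eigenvalues {S : Type*} [MeasurableSpace S] {n : ℕ}
    {F : S → Matrix (Fin n) (Fin n) ℂ} (hF : ∀ s, (F s).IsHermitian)
    (hm : ∀ i j, Measurable fun s => F s i j) : Measurable fun s => (hF s).eigenvalues := by
  let m := Fintype.card (Fin n)
  let K : Set (Fin m → ℝ) := {y | Antitone y}
  have hK : IsClosed K := by
    have : K = ⋂ (i) (j) (_ : i ≤ j), {y | y j ≤ y i} := by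
      ext y; simp [K, Antitone]
    rw [this]
    exact isClosed_iInter fun i => isClosed_iInter fun j => isClosed_iInter fun _ =>
      isClosed_le (continuous_apply j) (continuous_apply i)
  have : PolishSpace K := hK.polishSpace
  -- By Lusin–Souslin, a continuous injection on the Polish space of sorted vectors is a measurable
  -- embedding. Measurability of the sorted eigenvalues thus reduces to that of determinants, which
  -- are polynomial in the entries.
  let e : K → ℕ → ℝ := fun y t => ∏ k, ((t : ℝ) - y.1 k)
  have he : MeasurableEmbedding e := by
    refine Continuous.measurableEmbedding (continuous_pi fun t => ?_) ?_
    · change Continuous fun y : K => ∏ k, ((t : ℝ) - y.1 k)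
      exact continuous_finsetProd _ fun k _ =>
        continuous_const.sub ((continuous_apply k).comp continuous_subtype_val)
    intro y z hyz
    exact Subtype.ext (antitone_eq_of_prod_sub_eq y.2 z.2 fun t => congrFun hyz t)
  have h0 : Measurable fun s => (⟨(hF s).eigenvalues₀, (hF s).eigenvalues₀_antitone⟩ : K) := by
    rw [← he.measurable_comp_iff]
    refine measurable_pi_iff.2 fun t => ?_
    have : (fun s => (e ⟨(hF s).eigenvalues₀, (hF s).eigenvalues₀_antitone⟩) t) =
        fun s => ((Matrix.scalar (Fin n) (((t : ℝ)) : ℂ) - F s).det).re := by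
      funext s
      rw [← (hF s).prod_sub_eigenvalues₀, Complex.ofReal_re]
    change Measurable (fun s => (e ⟨(hF s).eigenvalues₀, (hF s).eigenvalues₀_antitone⟩) t)
    rw [this]
    refine Complex.measurable_re.comp ?_
    simp only [Matrix.det_apply, Matrix.sub_apply]
    fun_prop
  refine measurable_pi_iff.2 fun i => ?_
  exact (measurable_pi_apply _).comp (measurable_subtype_coe.comp h0)

/-! ### Rank one perturbations of diagonal matrices -/

/-- Factoring out the invertible diagonal leaves the identity plus a rank one matrix, to which the
matrix determinant lemma applies. -/
lemma det_diagonal_sub_vecMulVec_of_ne_zero {n : ℕ} {d : Fin n → ℂ} (hd : ∀ i, d i ≠ 0)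
    (u v : Fin n → ℂ) :
    (Matrix.diagonal d - Matrix.vecMulVec u v).det =
      ∏ i, d i - ∑ i, u i * v i * ∏ k ∈ Finset.univ.erase i, d k := by
  have hfac : Matrix.diagonal d - Matrix.vecMulVec u v =
      Matrix.diagonal d * (1 + Matrix.replicateCol Unit (fun i => -((d i)⁻¹ * u i)) *
        Matrix.replicateRow Unit v) := by
    rw [mul_add, mul_one, sub_eq_add_neg, ← Matrix.mul_assoc]
    congr 1
    ext i j
    simp [Matrix.vecMulVec, Matrix.mul_apply, Matrix.diagonal_apply, mul_inv_cancel_left₀ (hd i)]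
  rw [hfac, Matrix.det_mul, Matrix.det_diagonal, Matrix.det_one_add_replicateCol_mul_replicateRow,
    mul_add, mul_one, sub_eq_add_neg, dotProduct, Finset.mul_sum, ← Finset.sum_neg_distrib]
  congr 1
  refine Finset.sum_congr rfl fun i _ => ?_
  rw [← Finset.mul_prod_erase _ _ (Finset.mem_univ i)]
  field_simp [hd i]

lemma det_diagonal_sub_vecMulVec {n : ℕ} (d u v : Fin n → ℂ) :
    (Matrix.diagonal d - Matrix.vecMulVec u v).det =
      ∏ i, d i - ∑ i, u i * v i * ∏ k ∈ Finset.univ.erase i, d k := by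
  let f : ℂ → ℂ := fun s => (Matrix.diagonal (fun i => d i + s) - Matrix.vecMulVec u v).det
  let g : ℂ → ℂ := fun s =>
    ∏ i, (d i + s) - ∑ i, u i * v i * ∏ k ∈ Finset.univ.erase i, (d k + s)
  have hf : Continuous f := by
    refine Continuous.matrix_det (Continuous.sub (Continuous.matrix_diagonal ?_) ?_) <;> fun_prop
  have hg : Continuous g := by fun_prop
  -- Shifting the diagonal by a small nonzero `s` makes every entry nonzero; continuity then gives
  -- the identity at `s = 0`.
  have hev : ∀ᶠ s in nhdsWithin (0 : ℂ) {0}ᶜ, f s = g s := by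
    have h1 : ∀ i, ∀ᶠ s in nhdsWithin (0 : ℂ) {0}ᶜ, d i + s ≠ 0 := by
      intro i
      by_cases hi : d i = 0
      · filter_upwards [self_mem_nhdsWithin] with s hs
        simpa [hi] using hs
      · refine Filter.Eventually.filter_mono nhdsWithin_le_nhds ?_
        have : ContinuousAt (fun s : ℂ => d i + s) 0 := by fun_prop
        exact this.eventually_ne (by simpa using hi)
    filter_upwards [Filter.eventually_all.2 h1] with s hs
    exact det_diagonal_sub_vecMulVec_of_ne_zero hs u v
  have h := tendsto_nhds_unique_of_eventuallyEq
    ((hf.tendsto 0).mono_left nhdsWithin_le_nhds) ((hg.tendsto 0).mono_left nhdsWithin_le_nhds) hev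
  simpa [f, g] using h

/-- The diagonal matrix with real diagonal `x`, perturbed by the rank one matrix `w w^*`. -/
noncomputable def diagonalAddRankOne {n : ℕ} (x : Fin n → ℝ) (w : Fin n → ℂ) :
    Matrix (Fin n) (Fin n) ℂ :=
  Matrix.diagonal (fun i => (x i : ℂ)) + Matrix.vecMulVec w (star w)

lemma isHermitian_vecMulVec_star {n : ℕ} (w : Fin n → ℂ) :
    (Matrix.vecMulVec w (star w)).IsHermitian := by
  ext i j; simp [Matrix.vecMulVec_apply, mul_comm]

lemma isHermitian_diagonalAddRankOne {n : ℕ} (x : Fin n → ℝ) (w : Fin n → ℂ) :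
    (diagonalAddRankOne x w).IsHermitian := by
  refine Matrix.IsHermitian.add ?_ (isHermitian_vecMulVec_star w)
  exact Matrix.isHermitian_diagonal_of_self_adjoint _ (by ext i; simp)

/-- The eigenvalues of `diag x + w w^*`. -/
noncomputable def perturbedEigenvalues {n : ℕ} (x : Fin n → ℝ) (w : Fin n → ℂ) : Fin n → ℝ :=
  (isHermitian_diagonalAddRankOne x w).eigenvalues

/-- The characteristic polynomial of `diag x + w w^*` with `a = |w|^2`. -/
noncomputable def secular {n : ℕ} (x a : Fin n → ℝ) (t : ℝ) : ℝ :=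
  ∏ i, (t - x i) - ∑ i, a i * ∏ k ∈ Finset.univ.erase i, (t - x k)

lemma prod_sub_perturbedEigenvalues {n : ℕ} (x : Fin n → ℝ) (w : Fin n → ℂ) (t : ℝ) :
    ∏ k, (t - perturbedEigenvalues x w k) = secular x (fun i => Complex.normSq (w i)) t := by
  have h := (isHermitian_diagonalAddRankOne x w).prod_sub_eigenvalues t
  have hd : Matrix.scalar (Fin n) (t : ℂ) - diagonalAddRankOne x w =
      Matrix.diagonal (fun i => ((t - x i : ℝ) : ℂ)) - Matrix.vecMulVec w (star w) := by
    ext i j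
    by_cases hij : i = j <;> simp [diagonalAddRankOne, hij]
    ring
  rw [hd, det_diagonal_sub_vecMulVec] at h
  have h2 : ∀ i, w i * star w i = (Complex.normSq (w i) : ℂ) := fun i => by
    simp [Complex.mul_conj]
  simp only [h2] at h
  unfold secular perturbedEigenvalues
  exact_mod_cast h

lemma sum_perturbedEigenvalues {n : ℕ} (x : Fin n → ℝ) (w : Fin n → ℂ) :
    ∑ k, perturbedEigenvalues x w k = ∑ k, x k + ∑ k, Complex.normSq (w k) := by
  have h := (isHermitian_diagonalAddRankOne x w).trace_eq_sum_eigenvalues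
  have h1 : (diagonalAddRankOne x w).trace =
      ∑ k, (x k : ℂ) + (Matrix.vecMulVec w (star w)).trace := by
    rw [← Matrix.trace_diagonal, ← Matrix.trace_add]; rfl
  have h2 : (Matrix.vecMulVec w (star w)).trace = ∑ k, (Complex.normSq (w k) : ℂ) := by
    simp [Matrix.trace, Matrix.vecMulVec_apply, Complex.mul_conj]
  rw [h1, h2] at h
  apply Complex.ofReal_injective
  push_cast
  exact h.symm

/-- A rank one perturbation of a Hermitian matrix in terms of the eigenvalues of the matrix. -/
lemma eigenvalues_add_vecMulVec {n : ℕ} {A : Matrix (Fin n) (Fin n) ℂ} (hA : A.IsHermitian)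
    (v : Fin n → ℂ) :
    (hA.add (isHermitian_vecMulVec_star v)).eigenvalues =
      perturbedEigenvalues hA.eigenvalues
        ((star (hA.eigenvectorUnitary : Matrix (Fin n) (Fin n) ℂ)).mulVec v) := by
  unfold perturbedEigenvalues
  rw [Matrix.IsHermitian.eigenvalues_eq_eigenvalues_iff]
  set U : Matrix (Fin n) (Fin n) ℂ := hA.eigenvectorUnitary.1 with hU
  have hUU : U * star U = 1 := by simp [hU]
  have hUU' : star U * U = 1 := by simp [hU]
  have hfac : A + Matrix.vecMulVec v (star v) =
      U * (diagonalAddRankOne hA.eigenvalues ((star U).mulVec v)) * star U := by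
    have h1 : A = U * Matrix.diagonal (fun i => (hA.eigenvalues i : ℂ)) * star U := by
      conv_lhs => rw [hA.spectral_theorem]
      rw [Unitary.conjStarAlgAut_apply]; rfl
    have h2 : Matrix.vecMulVec v (star v) =
        U * Matrix.vecMulVec ((star U).mulVec v) (star ((star U).mulVec v)) * star U := by
      rw [Matrix.star_mulVec, Matrix.mul_vecMulVec, Matrix.vecMulVec_mul, Matrix.mulVec_mulVec,
        Matrix.vecMul_vecMul, hUU, Matrix.one_mulVec, ← Matrix.star_eq_conjTranspose, star_star,
        hUU, Matrix.vecMul_one]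
    rw [diagonalAddRankOne, mul_add, add_mul, ← h2, ← h1]
  rw [hfac, Matrix.charpoly_mul_comm, ← mul_assoc, hUU', one_mul]

/-- The Gram matrix of the enlarged matrix is `X^*X + v v^*`; in an eigenbasis of `X^*X` the vector
`v` becomes `U^*v`. -/
lemma sqSingularValues_appendRow {m n : ℕ} (X : Matrix (Fin m) (Fin n) ℂ) (v : Fin n → ℂ) :
    sqSingularValues (appendRow X v) =
      perturbedEigenvalues (sqSingularValues X)
        ((star ((Matrix.isHermitian_conjTranspose_mul_self X).eigenvectorUnitary :
          Matrix (Fin n) (Fin n) ℂ)).mulVec v) := by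
  refine Eq.trans ?_ (eigenvalues_add_vecMulVec _ v)
  unfold sqSingularValues
  rw [Matrix.IsHermitian.eigenvalues_eq_eigenvalues_iff]
  congr 1
  rw [appendRow, Matrix.conjTranspose_fromRows_eq_fromCols_conjTranspose,
    Matrix.fromCols_mul_fromRows]
  congr 1
  ext i j
  simp [Matrix.mul_apply, Matrix.vecMulVec_apply]

lemma measurable_sqSingularValues {S : Type*} [MeasurableSpace S] {m : Type*} [Fintype m] {n : ℕ}
    {F : S → Matrix m (Fin n) ℂ} (hm : ∀ i j, Measurable fun s => F s i j) :
    Measurable fun s => sqSingularValues (F s) := by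
  refine measurable_eigenvalues (fun s => Matrix.isHermitian_conjTranspose_mul_self (F s)) ?_
  intro i j
  simp only [Matrix.mul_apply, Matrix.conjTranspose_apply]
  fun_prop

lemma Measurable.perturbedEigenvalues {S : Type*} [MeasurableSpace S] {n : ℕ}
    {x : S → Fin n → ℝ} {w : S → Fin n → ℂ} (hx : Measurable x) (hw : Measurable w) :
    Measurable fun s => perturbedEigenvalues (x s) (w s) := by
  have h : ∀ i j, Measurable fun s => diagonalAddRankOne (x s) (w s) i j := by
    intro i j
    by_cases hij : i = j
    · subst hij
      simp only [diagonalAddRankOne, Matrix.add_apply, Matrix.diagonal_apply_eq,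
        Matrix.vecMulVec_apply, Pi.star_apply]
      fun_prop
    · simp only [diagonalAddRankOne, Matrix.add_apply, Matrix.diagonal_apply_ne _ hij,
        Matrix.vecMulVec_apply, Pi.star_apply]
      fun_prop
  exact measurable_eigenvalues (F := fun s => diagonalAddRankOne (x s) (w s))
    (fun s => isHermitian_diagonalAddRankOne (x s) (w s)) h

/-! ### Complex Gaussian vectors -/

lemma gaussianPDFReal_zero_half (x : ℝ) :
    gaussianPDFReal 0 (1 / 2) x = (√Real.pi)⁻¹ * Real.exp (-x ^ 2) := by
  rw [gaussianPDFReal]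
  have h1 : (2 : ℝ) * Real.pi * ((1 / 2 : NNReal) : ℝ) = Real.pi := by push_cast; ring
  have h2 : (2 : ℝ) * ((1 / 2 : NNReal) : ℝ) = 1 := by push_cast; ring
  rw [h1, h2]; simp

lemma lintegral_gaussianReal_prod (F : ℝ × ℝ → ℝ≥0∞) (hF : Measurable F) :
    ∫⁻ p, F p ∂((gaussianReal 0 (1 / 2)).prod (gaussianReal 0 (1 / 2))) =
      ∫⁻ p : ℝ × ℝ, ENNReal.ofReal (Real.pi⁻¹ * Real.exp (-(p.1 ^ 2 + p.2 ^ 2))) * F p := by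
  rw [gaussianReal_of_var_ne_zero _ (by norm_num), prod_withDensity (measurable_gaussianPDF _ _)
    (measurable_gaussianPDF _ _), lintegral_withDensity_eq_lintegral_mul _ ?_ hF,
    ← Measure.volume_eq_prod]
  · refine lintegral_congr fun p => ?_
    rw [Pi.mul_apply, gaussianPDF, gaussianPDF, gaussianPDFReal_zero_half,
      gaussianPDFReal_zero_half, ← ENNReal.ofReal_mul (by positivity)]
    congr 2
    rw [neg_add, Real.exp_add]
    have : (√Real.pi)⁻¹ * (√Real.pi)⁻¹ = Real.pi⁻¹ := by
      rw [← mul_inv, Real.mul_self_sqrt Real.pi_pos.le]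
    rw [← this]; ring
  · exact ((measurable_gaussianPDF _ _).comp measurable_fst).mul
      ((measurable_gaussianPDF _ _).comp measurable_snd)

lemma lintegral_Ioi_comp_sq (F : ℝ → ℝ≥0∞) :
    ∫⁻ r in Set.Ioi (0 : ℝ), ENNReal.ofReal (2 * r) * F (r ^ 2) = ∫⁻ t in Set.Ioi (0 : ℝ), F t := by
  have himg : (fun r : ℝ => r ^ 2) '' Set.Ioi 0 = Set.Ioi 0 := by
    ext t
    constructor
    · rintro ⟨r, hr, rfl⟩
      exact pow_pos (Set.mem_Ioi.1 hr) 2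
    · intro ht
      exact ⟨√t, Real.sqrt_pos.2 ht, Real.sq_sqrt (le_of_lt ht)⟩
  conv_rhs => rw [← himg]
  rw [lintegral_image_eq_lintegral_deriv_mul_of_monotoneOn (f' := fun r => 2 * r) measurableSet_Ioi]
  · intro r _
    simpa using (hasDerivAt_pow 2 r).hasDerivWithinAt
  · intro a ha b _ hab
    exact pow_le_pow_left₀ (le_of_lt ha) hab 2

/-- The density of the exponential distribution with parameter `1`. -/
noncomputable def expDensity (t : ℝ) : ℝ := (Set.Ioi (0 : ℝ)).indicator (fun t => Real.exp (-t)) t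

lemma expDensity_nonneg (t : ℝ) : 0 ≤ expDensity t :=
  Set.indicator_nonneg (fun _ _ => (Real.exp_pos _).le) _

lemma measurable_expDensity : Measurable expDensity :=
  Measurable.indicator (by fun_prop) measurableSet_Ioi

lemma integrable_expDensity : Integrable expDensity :=
  (integrable_indicator_iff measurableSet_Ioi).2 (by
    simpa using integrableOn_exp_mul_Ioi (a := -1) (by norm_num) 0)

/-- The squared modulus of a standard complex Gaussian variable is exponential. -/
lemma map_sq_add_sq_gaussianReal :
    ((gaussianReal 0 (1 / 2)).prod (gaussianReal 0 (1 / 2))).map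
      (fun p : ℝ × ℝ => p.1 ^ 2 + p.2 ^ 2) =
      volume.withDensity fun t => ENNReal.ofReal (expDensity t) := by
  refine Measure.ext_of_lintegral _ fun F hF => ?_
  rw [lintegral_map hF (by fun_prop), lintegral_gaussianReal_prod _ (by fun_prop),
    lintegral_withDensity_eq_lintegral_mul _ measurable_expDensity.ennreal_ofReal hF,
    ← lintegral_comp_polarCoord_symm]
  have hG : ∀ p : ℝ × ℝ, ENNReal.ofReal p.1 • (ENNReal.ofReal (Real.pi⁻¹ *
      Real.exp (-((polarCoord.symm p).1 ^ 2 + (polarCoord.symm p).2 ^ 2))) *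
        F ((polarCoord.symm p).1 ^ 2 + (polarCoord.symm p).2 ^ 2)) =
      ENNReal.ofReal p.1 * (ENNReal.ofReal (Real.pi⁻¹ * Real.exp (-p.1 ^ 2)) * F (p.1 ^ 2)) := by
    intro p
    have : (polarCoord.symm p).1 ^ 2 + (polarCoord.symm p).2 ^ 2 = p.1 ^ 2 := by
      simp only [polarCoord_symm_apply]
      rw [mul_pow, mul_pow, ← mul_add, Real.cos_sq_add_sin_sq, mul_one]
    rw [this, smul_eq_mul]
  simp only [hG]
  rw [polarCoord_target, Measure.volume_eq_prod, ← Measure.prod_restrict,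
    lintegral_prod _ (by fun_prop)]
  simp only [lintegral_const, Measure.restrict_apply MeasurableSet.univ, Set.univ_inter,
    Real.volume_Ioo]
  have hR : ∫⁻ t, ((fun t => ENNReal.ofReal (expDensity t)) * F) t =
      ∫⁻ t in Set.Ioi (0 : ℝ), ENNReal.ofReal (Real.exp (-t)) * F t := by
    rw [← lintegral_indicator measurableSet_Ioi]
    refine lintegral_congr fun t => ?_
    by_cases ht : t ∈ Set.Ioi (0 : ℝ) <;> simp [expDensity, ht]
  rw [hR, ← lintegral_Ioi_comp_sq fun t => ENNReal.ofReal (Real.exp (-t)) * F t]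
  refine setLIntegral_congr_fun measurableSet_Ioi fun r hr => ?_
  have hr' : (0 : ℝ) < r := hr
  have hpi := Real.pi_pos
  -- The angle contributes a factor `2π`, and `2π * π⁻¹ * r dr = 2r dr = d(r^2)`.
  have e : ENNReal.ofReal (2 * r) * ENNReal.ofReal (Real.exp (-r ^ 2)) =
      ENNReal.ofReal r * ENNReal.ofReal (Real.pi⁻¹ * Real.exp (-r ^ 2)) *
        ENNReal.ofReal (Real.pi - -Real.pi) := by
    rw [← ENNReal.ofReal_mul (by positivity), ← ENNReal.ofReal_mul (by positivity),
      ← ENNReal.ofReal_mul (by positivity)]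
    congr 1
    field_simp
    ring
  rw [← mul_assoc (ENNReal.ofReal (2 * r)), e]
  ring

lemma pi_withDensity_ofReal {ι : Type*} [Fintype ι] {h : ℝ → ℝ} (h0 : ∀ t, 0 ≤ h t) (hi : Integrable h) :
    Measure.pi (fun _ : ι => volume.withDensity fun t => ENNReal.ofReal (h t)) =
      (volume : Measure (ι → ℝ)).withDensity fun a => ENNReal.ofReal (∏ i, h (a i)) := by
  have : IsFiniteMeasure (volume.withDensity fun t => ENNReal.ofReal (h t)) :=
    isFiniteMeasure_withDensity_ofReal hi.2
  refine Measure.pi_eq fun s hs => ?_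
  rw [withDensity_apply _ (MeasurableSet.univ_pi hs), ← lintegral_indicator
    (MeasurableSet.univ_pi hs)]
  have e1 : ∀ a : ι → ℝ, (Set.univ.pi s).indicator
      (fun a => ENNReal.ofReal (∏ i, h (a i))) a =
      ENNReal.ofReal (∏ i, (s i).indicator h (a i)) := by
    intro a
    by_cases ha : a ∈ Set.univ.pi s
    · rw [Set.indicator_of_mem ha]
      congr 1
      exact Finset.prod_congr rfl fun i _ => (Set.indicator_of_mem (ha i trivial) _).symm
    · rw [Set.indicator_of_notMem ha]
      simp only [Set.mem_pi, Set.mem_univ, true_implies, not_forall] at ha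
      obtain ⟨i, hi⟩ := ha
      rw [Finset.prod_eq_zero (Finset.mem_univ i) (Set.indicator_of_notMem hi _),
        ENNReal.ofReal_zero]
  simp only [e1]
  have hint : ∀ i, Integrable ((s i).indicator h) := fun i => hi.indicator (hs i)
  have hnn : ∀ i t, 0 ≤ (s i).indicator h t := fun i t => Set.indicator_nonneg (fun _ _ => h0 _) _
  rw [volume_pi, ← ofReal_integral_eq_lintegral_ofReal
    (Integrable.fintype_prod_dep hint)
    (Filter.Eventually.of_forall fun a => Finset.prod_nonneg fun i _ => hnn i _),
    integral_fintype_prod_eq_prod, ENNReal.ofReal_prod_of_nonneg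
      fun i _ => integral_nonneg (hnn i)]
  refine Finset.prod_congr rfl fun i _ => ?_
  rw [withDensity_apply _ (hs i), ofReal_integral_eq_lintegral_ofReal (hint i)
    (Filter.Eventually.of_forall (hnn i)), ← lintegral_indicator (hs i)]
  refine lintegral_congr fun t => ?_
  by_cases ht : t ∈ s i <;> simp [ht]

/-- The complex vector with real parts `W (inl j)` and imaginary parts `W (inr j)`. -/
noncomputable def toComplexVector {n : ℕ} (W : Fin n ⊕ Fin n → ℝ) (j : Fin n) : ℂ :=
  ⟨W (Sum.inl j), W (Sum.inr j)⟩

lemma measurable_toComplexVector {n : ℕ} : Measurable (toComplexVector (n := n)) := by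
  refine measurable_pi_iff.2 fun j => ?_
  have h : Measurable fun W : Fin n ⊕ Fin n → ℝ => (W (Sum.inl j), W (Sum.inr j)) := by fun_prop
  exact Complex.measurableEquivRealProd.symm.measurable.comp h

/-- The law of a standard complex Gaussian vector. -/
noncomputable def complexGaussian (n : ℕ) : Measure (Fin n → ℂ) :=
  (Measure.pi fun _ : Fin n ⊕ Fin n => gaussianReal 0 (1 / 2)).map toComplexVector

instance (n : ℕ) : IsProbabilityMeasure (complexGaussian n) :=
  Measure.isProbabilityMeasure_map measurable_toComplexVector.aemeasurable

lemma IsStandardComplexGaussianVector.aemeasurable_and_map_eq {Ω : Type*} [MeasurableSpace Ω]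
    {n : ℕ} {P : Measure Ω} [IsProbabilityMeasure P] {v : Ω → Fin n → ℂ}
    (hv : IsStandardComplexGaussianVector P v) :
    AEMeasurable v P ∧ P.map v = complexGaussian n := by
  set W : Fin n ⊕ Fin n → Ω → ℝ :=
    Sum.elim (fun (j : Fin n) (ω : Ω) => (v ω j).re) (fun (j : Fin n) (ω : Ω) => (v ω j).im)
  have hW : ∀ s, HasLaw (W s) (gaussianReal 0 (1 / 2)) P := by
    rintro (j | j)
    · exact hv.hasLaw_re j
    · exact hv.hasLaw_im j
  have hWm : AEMeasurable (fun ω s => W s ω) P := aemeasurable_pi_iff.2 fun s => (hW s).aemeasurable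
  have hvW : v = toComplexVector ∘ fun ω s => W s ω := by
    funext ω j; rfl
  refine ⟨hvW ▸ measurable_toComplexVector.comp_aemeasurable hWm, ?_⟩
  rw [hvW, ← AEMeasurable.map_map_of_aemeasurable measurable_toComplexVector.aemeasurable hWm,
    (iIndepFun_iff_map_fun_eq_pi_map fun s => (hW s).aemeasurable).1 hv.indep, complexGaussian]
  simp only [fun s => (hW s).map_eq]

lemma map_normSq_complexGaussian (n : ℕ) :
    (complexGaussian n).map (fun w j => Complex.normSq (w j)) =
      (volume : Measure (Fin n → ℝ)).withDensity
        fun a => ENNReal.ofReal (∏ i, expDensity (a i)) := by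
  have hcm : Measurable fun (w : Fin n → ℂ) j => Complex.normSq (w j) :=
    measurable_pi_iff.2 fun j =>
      Complex.continuous_normSq.measurable.comp (measurable_pi_apply j)
  rw [← pi_withDensity_ofReal expDensity_nonneg integrable_expDensity,
    ← map_sq_add_sq_gaussianReal, complexGaussian, Measure.map_map hcm measurable_toComplexVector]
  have h1 := (measurePreserving_sumPiEquivProdPi
    (fun _ : Fin n ⊕ Fin n => gaussianReal 0 (1 / 2)))
  have h2 := (measurePreserving_arrowProdEquivProdArrow ℝ ℝ (Fin n)
    (fun _ => gaussianReal 0 (1 / 2)) (fun _ => gaussianReal 0 (1 / 2))).symm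
  have h3 := (h2.comp h1).map_eq
  have hp : ∀ _ : Fin n, IsProbabilityMeasure (((gaussianReal 0 (1 / 2)).prod
      (gaussianReal 0 (1 / 2))).map (fun p : ℝ × ℝ => p.1 ^ 2 + p.2 ^ 2)) :=
    fun _ => Measure.isProbabilityMeasure_map (by fun_prop)
  rw [← Measure.pi_map_pi (fun _ => by fun_prop), ← h3, Measure.map_map]
  · congr 1
    funext W j
    simp only [Function.comp_apply, toComplexVector, Complex.normSq_mk]
    rw [pow_two, pow_two]; rfl
  · fun_prop
  · exact (h2.comp h1).measurable

/-- The characteristic function at a functional depends only on the sum of squares of its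
coefficients, which an orthogonal matrix preserves. -/
lemma map_pi_gaussianReal_mulVec {ι : Type*} [Fintype ι] [DecidableEq ι] (c : NNReal)
    {T : Matrix ι ι ℝ} (hT : T * T.transpose = 1) :
    (Measure.pi fun _ : ι => gaussianReal 0 c).map T.mulVec =
      Measure.pi fun _ : ι => gaussianReal 0 c := by
  let L : (ι → ℝ) →L[ℝ] (ι → ℝ) := LinearMap.toContinuousLinearMap T.mulVecLin
  have hL : T.mulVec = L := rfl
  have hg : ∀ M : StrongDual ℝ (ι → ℝ),
      charFunDual (Measure.pi fun _ : ι => gaussianReal 0 c) M =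
        Complex.exp (((-(c * ∑ i, M (Pi.single i 1) ^ 2) / 2 : ℝ)) : ℂ) := by
    intro M
    rw [charFunDual_pi]
    have : ∀ i, charFunDual (gaussianReal 0 c)
        (M.comp (ContinuousLinearMap.single ℝ (fun _ : ι => ℝ) i)) =
        Complex.exp (((-(c * M (Pi.single i 1) ^ 2) / 2 : ℝ)) : ℂ) := by
      intro i
      set N := M.comp (ContinuousLinearMap.single ℝ (fun _ : ι => ℝ) i)
      have hN : ∀ t, N t = M (Pi.single i 1) * t := by
        intro t
        have h1 : N t = t • N 1 := by
          rw [← map_smul]; simp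
        rw [h1, smul_eq_mul, mul_comm]; rfl
      have : charFunDual (gaussianReal 0 c) N = charFun (gaussianReal 0 c) (M (Pi.single i 1)) := by
        rw [charFunDual_apply, charFun_apply_real]
        simp [hN]
      rw [this, charFun_gaussianReal]
      congr 1
      push_cast
      ring
    simp only [this]
    rw [← Complex.exp_sum, ← Complex.ofReal_sum]
    congr 2
    rw [Finset.mul_sum, ← Finset.sum_neg_distrib, Finset.sum_div]
  have hfin : IsFiniteMeasure ((Measure.pi fun _ : ι => gaussianReal 0 c).map L) :=
    Measure.isFiniteMeasure_map _ _
  rw [hL]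
  refine Measure.ext_of_charFunDual (funext fun M => ?_)
  rw [charFunDual_map, hg, hg]
  have hM : ∀ x, M x = ∑ s, M (Pi.single s 1) * x s := by
    intro x
    conv_lhs => rw [← Finset.univ_sum_single x]
    rw [map_sum]
    refine Finset.sum_congr rfl fun s _ => ?_
    have : (Pi.single s (x s) : ι → ℝ) = x s • Pi.single s 1 := by
      rw [← Pi.single_smul, smul_eq_mul, mul_one]
    rw [this, map_smul, smul_eq_mul, mul_comm]
  have key : ∑ i, (M.comp L) (Pi.single i 1) ^ 2 = ∑ i, M (Pi.single i 1) ^ 2 := by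
    set m : ι → ℝ := fun s => M (Pi.single s 1)
    have h1 : ∀ i, (M.comp L) (Pi.single i 1) = (Matrix.vecMul m T) i := by
      intro i
      rw [ContinuousLinearMap.comp_apply, hM]
      have : L (Pi.single i 1) = fun s => T s i := by
        rw [← hL, Matrix.mulVec_single_one]; rfl
      rw [this]; rfl
    simp only [h1, pow_two]
    change (Matrix.vecMul m T) ⬝ᵥ (Matrix.vecMul m T) = m ⬝ᵥ m
    nth_rewrite 2 [← Matrix.mulVec_transpose]
    rw [Matrix.dotProduct_mulVec, Matrix.vecMul_vecMul, hT, Matrix.vecMul_one]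
  rw [key]

/-- The standard complex Gaussian law is invariant under unitary matrices. -/
lemma map_mulVec_complexGaussian {n : ℕ} {U : Matrix (Fin n) (Fin n) ℂ} (hU : U * star U = 1) :
    (complexGaussian n).map U.mulVec = complexGaussian n := by
  set R : Matrix (Fin n) (Fin n) ℝ := U.map Complex.re
  set I : Matrix (Fin n) (Fin n) ℝ := U.map Complex.im
  -- The action of `U` on real and imaginary parts. The real and imaginary parts of `U U^* = 1` say
  -- exactly that this real matrix is orthogonal.
  let T : Matrix (Fin n ⊕ Fin n) (Fin n ⊕ Fin n) ℝ := Matrix.fromBlocks R (-I) I R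
  have hre : R * R.transpose + I * I.transpose = 1 := by
    ext i j
    have := congrArg Complex.re (congrFun (congrFun hU i) j)
    simp only [Matrix.mul_apply, Matrix.star_apply, Complex.re_sum, Complex.mul_re,
      RCLike.star_def, Complex.conj_re, Complex.conj_im] at this
    simp only [Matrix.add_apply, Matrix.mul_apply, Matrix.transpose_apply, R, I, Matrix.map_apply]
    rw [← Finset.sum_add_distrib]
    refine Eq.trans (Finset.sum_congr rfl fun k _ => by ring) (this.trans ?_)
    by_cases hij : i = j <;> simp [Matrix.one_apply, hij]
  have him : I * R.transpose - R * I.transpose = 0 := by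
    ext i j
    have := congrArg Complex.im (congrFun (congrFun hU i) j)
    simp only [Matrix.mul_apply, Matrix.star_apply, Complex.im_sum, Complex.mul_im,
      RCLike.star_def, Complex.conj_re, Complex.conj_im] at this
    simp only [Matrix.sub_apply, Matrix.mul_apply, Matrix.transpose_apply, R, I, Matrix.map_apply]
    rw [← Finset.sum_sub_distrib]
    refine Eq.trans (Finset.sum_congr rfl fun k _ => by ring) (this.trans ?_)
    by_cases hij : i = j <;> simp [Matrix.one_apply, hij]
  have hT : T * T.transpose = 1 := by
    simp only [T, Matrix.fromBlocks_transpose, Matrix.fromBlocks_multiply, Matrix.transpose_neg]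
    rw [← Matrix.fromBlocks_one]
    congr 1
    · rw [Matrix.neg_mul, Matrix.mul_neg, neg_neg, hre]
    · rw [Matrix.neg_mul, ← sub_eq_add_neg, ← neg_sub, him, neg_zero]
    · rw [Matrix.mul_neg, ← sub_eq_add_neg, him]
    · rw [add_comm, hre]
  have hcomm : U.mulVec ∘ toComplexVector = toComplexVector ∘ T.mulVec := by
    funext W j
    apply Complex.ext
    · simp [toComplexVector, Matrix.mulVec, dotProduct, T, R, I,
        sub_eq_add_neg, Finset.sum_add_distrib]
    · simp [toComplexVector, Matrix.mulVec, dotProduct, T, R, I, Finset.sum_add_distrib, add_comm]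
  have hUm : Measurable (U.mulVec) := (Continuous.matrix_mulVec continuous_const
    continuous_id).measurable
  have hTm : Measurable (T.mulVec) := (Continuous.matrix_mulVec continuous_const
    continuous_id).measurable
  rw [complexGaussian, Measure.map_map hUm measurable_toComplexVector, hcomm,
    ← Measure.map_map measurable_toComplexVector hTm, map_pi_gaussianReal_mulVec _ hT]

/-! ### Interlacing points and the weights of a rank one perturbation -/

/-- The points interlace: `x_1 < y_1 < x_2 < y_2 < ... < x_n < y_n`. -/
def Interlaces {n : ℕ} (x y : Fin n → ℝ) : Prop :=
  (∀ i, x i < y i) ∧ ∀ i j, i < j → y i < x j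

lemma Interlaces.strictMono_left {n : ℕ} {x y : Fin n → ℝ} (h : Interlaces x y) : StrictMono x :=
  fun i j hij => (h.1 i).trans (h.2 i j hij)

lemma Interlaces.strictMono_right {n : ℕ} {x y : Fin n → ℝ} (h : Interlaces x y) : StrictMono y :=
  fun i j hij => (h.2 i j hij).trans (h.1 j)

lemma measurableSet_interlaces {n : ℕ} :
    MeasurableSet {p : (Fin n → ℝ) × (Fin n → ℝ) | Interlaces p.1 p.2} := by
  simp only [Interlaces, Set.ofPred_and, Set.ofPred_forall]
  refine MeasurableSet.inter (MeasurableSet.iInter fun i => ?_) (MeasurableSet.iInter fun i =>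
    MeasurableSet.iInter fun j => MeasurableSet.iInter fun _ => ?_)
  · exact measurableSet_lt (by fun_prop) (by fun_prop)
  · exact measurableSet_lt (by fun_prop) (by fun_prop)

/-- The weights `a` for which the polynomial with roots `y` is `secular x a`. -/
noncomputable def weights {n : ℕ} (x y : Fin n → ℝ) (i : Fin n) : ℝ :=
  -(∏ k, (x i - y k)) / ∏ k ∈ Finset.univ.erase i, (x i - x k)

lemma secular_node {n : ℕ} (x a : Fin n → ℝ) (i : Fin n) :
    secular x a (x i) = -(a i * ∏ k ∈ Finset.univ.erase i, (x i - x k)) := by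
  rw [secular, Finset.prod_eq_zero (Finset.mem_univ i) (sub_self _), zero_sub,
    Finset.sum_eq_single i]
  · intro j _ hji
    rw [Finset.prod_eq_zero (Finset.mem_erase.2 ⟨hji.symm, Finset.mem_univ i⟩) (sub_self _),
      mul_zero]
  · simp

lemma prod_erase_sub_ne_zero {n : ℕ} {x : Fin n → ℝ} (hx : Function.Injective x) (i : Fin n) :
    ∏ k ∈ Finset.univ.erase i, (x i - x k) ≠ 0 :=
  Finset.prod_ne_zero_iff.2 fun _ hk =>
    sub_ne_zero.2 fun h => (Finset.ne_of_mem_erase hk) (hx h).symm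

open Polynomial in
-- Both sides are monic of degree `n`, so their difference has degree below `n`; the weights are
-- chosen to make it vanish at the `n` distinct nodes `x i`.
lemma prod_sub_eq_secular_weights {n : ℕ} {x : Fin n → ℝ} (hx : Function.Injective x)
    (y : Fin n → ℝ) (t : ℝ) : ∏ k, (t - y k) = secular x (weights x y) t := by
  let p : ℝ[X] := ∏ k, (X - C (y k))
  let q : ℝ[X] := ∏ k, (X - C (x k))
  let r : ℝ[X] := ∑ i, C (weights x y i) * ∏ k ∈ Finset.univ.erase i, (X - C (x k))
  have hr : r.degree < (n : WithBot ℕ) := by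
    refine (degree_sum_le _ _).trans_lt ((Finset.sup_lt_iff (WithBot.bot_lt_coe n)).2 fun i _ => ?_)
    rw [← smul_eq_C_mul]
    refine (degree_smul_le _ _).trans_lt ?_
    rw [degree_prod]
    simp only [degree_X_sub_C, Finset.sum_const, Finset.card_erase_of_mem (Finset.mem_univ i),
      Finset.card_univ, Fintype.card_fin, nsmul_eq_mul, mul_one]
    have := i.pos
    exact Nat.cast_lt.2 (Nat.sub_lt this one_pos)
  have hpq : (p - q).degree < (n : WithBot ℕ) := by
    have hpm : p.Monic := monic_prod_of_monic _ _ fun k _ => monic_X_sub_C _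
    have hqm : q.Monic := monic_prod_of_monic _ _ fun k _ => monic_X_sub_C _
    have hpd : p.degree = n := by simp [p, degree_prod]
    have hqd : q.degree = n := by simp [q, degree_prod]
    have := degree_sub_lt_left (hpd.trans hqd.symm) hpm.ne_zero (by rw [hpm, hqm])
    rwa [hpd] at this
  have heq : p = q - r := by
    refine eq_of_degree_sub_lt_of_eval_index_eq Finset.univ (v := x) hx.injOn ?_ ?_
    · rw [Finset.card_univ, Fintype.card_fin, sub_sub_eq_add_sub, add_sub_right_comm]
      exact (degree_add_le _ _).trans_lt (max_lt hpq hr)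
    · intro i _
      have h1 : (q - r).eval (x i) = secular x (weights x y) (x i) := by
        simp [q, r, secular, eval_finsetSum, eval_prod]
      rw [h1, secular_node, weights, div_mul_cancel₀ _ (prod_erase_sub_ne_zero hx i), neg_neg]
      simp [p, eval_prod]
  have := congrArg (eval t) heq
  simpa [p, q, r, secular, eval_finsetSum, eval_prod] using this

lemma Interlaces.weights_pos {n : ℕ} {x y : Fin n → ℝ} (h : Interlaces x y) (i : Fin n) :
    0 < weights x y i := by
  have : weights x y i = (y i - x i) * ∏ k ∈ Finset.univ.erase i, (x i - y k) / (x i - x k) := by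
    rw [weights, ← Finset.mul_prod_erase _ _ (Finset.mem_univ i), Finset.prod_div_distrib]
    ring
  rw [this]
  refine mul_pos (sub_pos.2 (h.1 i)) (Finset.prod_pos fun k hk => ?_)
  rcases lt_or_gt_of_ne (Finset.ne_of_mem_erase hk) with hki | hki
  · exact div_pos (sub_pos.2 (h.2 k i hki)) (sub_pos.2 (h.strictMono_left hki))
  · have h1 := h.strictMono_left hki
    have h2 := h.1 k
    exact div_pos_of_neg_of_neg (by linarith) (by linarith)

lemma continuous_secular {n : ℕ} (x a : Fin n → ℝ) : Continuous (secular x a) := by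
  unfold secular; fun_prop

/-- No node lies strictly between `x i` and `x j`, so the factors from all other nodes have equal
signs at both points. Only the mutual factors `x i - x j` and `x j - x i` differ in sign. -/
lemma secular_mul_secular_neg {n : ℕ} {x a : Fin n → ℝ} (hx : StrictMono x) (ha : ∀ i, 0 < a i)
    {i j : Fin n} (hij : i < j) (hadj : ∀ k, k < j → k ≤ i) :
    secular x a (x i) * secular x a (x j) < 0 := by
  rw [secular_node, secular_node]
  have hj : j ∈ Finset.univ.erase i := Finset.mem_erase.2 ⟨hij.ne', Finset.mem_univ _⟩
  have hi : i ∈ Finset.univ.erase j := Finset.mem_erase.2 ⟨hij.ne, Finset.mem_univ _⟩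
  rw [← Finset.mul_prod_erase _ _ hj, ← Finset.mul_prod_erase _ _ hi, Finset.erase_right_comm]
  have hpos : 0 < (∏ k ∈ (Finset.univ.erase j).erase i, (x i - x k)) *
      ∏ k ∈ (Finset.univ.erase j).erase i, (x j - x k) := by
    rw [← Finset.prod_mul_distrib]
    refine Finset.prod_pos fun k hk => ?_
    have hki := Finset.ne_of_mem_erase hk
    have hkj := Finset.ne_of_mem_erase (Finset.mem_of_mem_erase hk)
    rcases lt_or_gt_of_ne hkj with h | h
    · have h1 := hx (lt_of_le_of_ne (hadj k h) hki)
      have h2 := hx h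
      exact mul_pos (by linarith) (by linarith)
    · have h1 := hx h
      have h2 := hx (hij.trans h)
      exact mul_pos_of_neg_of_neg (by linarith) (by linarith)
  have h1 := hx hij
  have h2 := mul_pos (mul_pos (ha i) (ha j)) (mul_pos (sub_pos.2 h1) (sub_pos.2 h1))
  nlinarith [mul_pos h2 hpos]

/-- Divided by `∏ (t - x k)`, the polynomial becomes `1 - ∑ a j / (t - x j)`, and each denominator
is at least `∑ a j`. -/
lemma secular_nonneg_of_large {n : ℕ} {x a : Fin n → ℝ} (ha : ∀ i, 0 < a i) {t : ℝ}
    (i : Fin n) (ht : ∀ k, ∑ j, a j ≤ t - x k) : 0 ≤ secular x a t := by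
  have hS : 0 < ∑ j, a j := Finset.sum_pos (fun j _ => ha j) ⟨i, Finset.mem_univ i⟩
  have hterm : ∀ j, a j * ∏ k ∈ Finset.univ.erase j, (t - x k) ≤
      a j * ((∑ j, a j)⁻¹ * ∏ k, (t - x k)) := by
    intro j
    refine mul_le_mul_of_nonneg_left ?_ (ha j).le
    rw [← Finset.mul_prod_erase _ _ (Finset.mem_univ j), ← mul_assoc]
    refine le_mul_of_one_le_left (Finset.prod_nonneg fun k _ => hS.le.trans (ht k)) ?_
    rw [← div_eq_inv_mul]
    exact (one_le_div hS).2 (ht j)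
  have := Finset.sum_le_sum fun j (_ : j ∈ Finset.univ) => hterm j
  rw [← Finset.sum_mul, mul_inv_cancel_left₀ hS.ne'] at this
  rw [secular]
  linarith

lemma exists_root_secular {n : ℕ} {x a : Fin n → ℝ} (hx : StrictMono x) (ha : ∀ i, 0 < a i)
    (i : Fin n) : ∃ c, x i < c ∧ (∀ j, i < j → c < x j) ∧ secular x a c = 0 := by
  by_cases hi : (i : ℕ) + 1 < n
  · let j : Fin n := ⟨i + 1, hi⟩
    have hij : i < j := Fin.lt_def.2 (Nat.lt_succ_self _)
    have hneg := secular_mul_secular_neg hx ha hij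
      fun k hk => Fin.le_def.2 (Nat.lt_succ_iff.1 (Fin.lt_def.1 hk))
    have hne : secular x a (x i) ≠ 0 := fun h => by simp [h] at hneg
    have hc : Continuous fun t => secular x a (x i) * secular x a t :=
      continuous_const.mul (continuous_secular x a)
    obtain ⟨c, hc1, hc2⟩ := intermediate_value_Ioo' (hx hij).le hc.continuousOn
      ⟨hneg, mul_self_pos.2 hne⟩
    refine ⟨c, hc1.1, fun k hk => hc1.2.trans_le (hx.monotone ?_), ?_⟩
    · exact Fin.le_def.2 (Nat.succ_le_of_lt (Fin.lt_def.1 hk))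
    · exact (mul_eq_zero.1 hc2).resolve_left hne
  · have hmax : ∀ k : Fin n, k ≤ i := fun k => Fin.le_def.2 (by omega)
    have hS : 0 < ∑ j, a j := Finset.sum_pos (fun j _ => ha j) ⟨i, Finset.mem_univ i⟩
    have hneg : secular x a (x i) < 0 := by
      rw [secular_node, neg_lt_zero]
      refine mul_pos (ha i) (Finset.prod_pos fun k hk => sub_pos.2 (hx ?_))
      exact lt_of_le_of_ne (hmax k) (Finset.ne_of_mem_erase hk)
    have hpos : 0 ≤ secular x a (x i + ∑ j, a j) :=
      secular_nonneg_of_large ha i fun k => by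
        have := hx.monotone (hmax k)
        linarith
    -- The right endpoint must be allowed: for `n = 1` it is the root itself.
    obtain ⟨c, hc1, hc2⟩ := intermediate_value_Ioc (by linarith : x i ≤ x i + ∑ j, a j)
      (continuous_secular x a).continuousOn ⟨hneg, hpos⟩
    exact ⟨c, hc1.1, fun j hj => absurd hj (not_lt.2 (hmax j)), hc2⟩

lemma normSq_sqrt {a : ℝ} (ha : 0 ≤ a) : Complex.normSq ((√a : ℝ) : ℂ) = a := by
  rw [Complex.normSq_ofReal, Real.mul_self_sqrt ha]

lemma exists_interlaces_weights_eq {n : ℕ} {x a : Fin n → ℝ} (hx : StrictMono x)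
    (ha : ∀ i, 0 < a i) : ∃ y, Interlaces x y ∧ weights x y = a := by
  choose y hy1 hy2 hy3 using fun i => exists_root_secular hx ha i
  have hy : Interlaces x y := ⟨hy1, hy2⟩
  refine ⟨y, hy, ?_⟩
  -- Realising `secular x a` as the characteristic polynomial of a Hermitian matrix splits it into
  -- `n` real linear factors. The `n` distinct roots `y` found above must then exhaust the `z`.
  let z := perturbedEigenvalues x fun i => ((√(a i) : ℝ) : ℂ)
  have hz : ∀ t, ∏ k, (t - z k) = secular x a t := by
    intro t
    rw [prod_sub_perturbedEigenvalues]
    congr 1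
    funext i
    exact normSq_sqrt (ha i).le
  have hex : ∀ i, ∃ j, y i = z j := by
    intro i
    have h0 : ∏ k, (y i - z k) = 0 := by rw [hz, hy3]
    obtain ⟨j, -, hj⟩ := Finset.prod_eq_zero_iff.1 h0
    exact ⟨j, sub_eq_zero.1 hj⟩
  choose s hs using hex
  have hinj : Function.Injective s := fun i j hij => hy.strictMono_right.injective
    (by rw [hs, hs, hij])
  funext i
  have h1 : ∏ k, (x i - y k) = secular x a (x i) := by
    rw [← hz, ← Equiv.prod_comp (Equiv.ofBijective s (Finite.injective_iff_bijective.1 hinj))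
      fun k => x i - z k]
    exact Finset.prod_congr rfl fun k _ => by rw [hs]; rfl
  rw [weights, h1, secular_node, neg_neg, mul_div_cancel_right₀ _
    (prod_erase_sub_ne_zero hx.injective i)]

lemma image_weights {n : ℕ} {x : Fin n → ℝ} (hx : StrictMono x) :
    weights x '' {y | Interlaces x y} = {a | ∀ i, 0 < a i} := by
  ext a
  constructor
  · rintro ⟨y, hy, rfl⟩ i
    exact hy.weights_pos i
  · intro ha
    obtain ⟨y, hy, h⟩ := exists_interlaces_weights_eq hx ha
    exact ⟨y, hy, h⟩

lemma Interlaces.eq_of_eq {n : ℕ} {x y z : Fin n → ℝ} (hy : Interlaces x y) (hz : Interlaces x z)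
    {i j : Fin n} (h : y i = z j) : i = j := by
  rcases lt_trichotomy i j with hij | hij | hij
  · exact absurd h ((hy.2 i j hij).trans (hz.1 j)).ne
  · exact hij
  · exact absurd h.symm ((hz.2 j i hij).trans (hy.1 i)).ne

/-- The weights determine the polynomial, hence its roots up to order; the disjoint interlacing
intervals fix the order. -/
lemma injOn_weights {n : ℕ} {x : Fin n → ℝ} (hx : StrictMono x) :
    Set.InjOn (weights x) {y | Interlaces x y} := by
  intro y hy z hz hyz
  obtain ⟨σ, hσ⟩ := exists_perm_of_prod_sub_eq (y := y) (z := z)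
    (Interlaces.strictMono_right hy).injective fun t => by
      rw [prod_sub_eq_secular_weights hx.injective, hyz,
        ← prod_sub_eq_secular_weights hx.injective]
  funext i
  have h1 : y i = z (σ i) := congrFun hσ i
  rwa [← Interlaces.eq_of_eq hy hz h1] at h1

lemma exists_perm_perturbedEigenvalues {n : ℕ} {x y : Fin n → ℝ} (hy : Interlaces x y)
    {w : Fin n → ℂ} (hw : ∀ i, Complex.normSq (w i) = weights x y i) :
    ∃ σ : Equiv.Perm (Fin n), y = perturbedEigenvalues x w ∘ σ := by
  refine exists_perm_of_prod_sub_eq hy.strictMono_right.injective fun t => ?_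
  rw [prod_sub_eq_secular_weights hy.strictMono_left.injective, prod_sub_perturbedEigenvalues]
  congr 1
  exact (funext hw).symm

lemma perturbedEigenvalues_eq_of_secular_eq {n : ℕ} {x x' : Fin n → ℝ} {w w' : Fin n → ℂ}
    (h : ∀ t, secular x (fun i => Complex.normSq (w i)) t =
      secular x' (fun i => Complex.normSq (w' i)) t) :
    perturbedEigenvalues x w = perturbedEigenvalues x' w' := by
  unfold perturbedEigenvalues
  rw [Matrix.IsHermitian.eigenvalues_eq_eigenvalues_iff]
  refine Polynomial.eq_of_infinite_eval_eq _ _ ((Set.infinite_range_of_injective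
    Complex.ofReal_injective).mono ?_)
  rintro _ ⟨t, rfl⟩
  simp only [Set.mem_ofPred_eq, Matrix.eval_charpoly]
  rw [← (isHermitian_diagonalAddRankOne x w).prod_sub_eigenvalues t,
    ← (isHermitian_diagonalAddRankOne x' w').prod_sub_eigenvalues t]
  congr 1
  change ∏ k, (t - perturbedEigenvalues x w k) = ∏ k, (t - perturbedEigenvalues x' w' k)
  rw [prod_sub_perturbedEigenvalues, prod_sub_perturbedEigenvalues, h]

lemma perturbedEigenvalues_congr {n : ℕ} (x : Fin n → ℝ) {w w' : Fin n → ℂ}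
    (h : ∀ i, Complex.normSq (w i) = Complex.normSq (w' i)) :
    perturbedEigenvalues x w = perturbedEigenvalues x w' :=
  perturbedEigenvalues_eq_of_secular_eq fun t => by rw [funext h]

lemma perturbedEigenvalues_comp_perm {n : ℕ} (σ : Equiv.Perm (Fin n)) (x : Fin n → ℝ)
    (w : Fin n → ℂ) : perturbedEigenvalues (x ∘ σ) (w ∘ σ) = perturbedEigenvalues x w := by
  refine perturbedEigenvalues_eq_of_secular_eq fun t => ?_
  unfold secular
  congr 1
  · exact Equiv.prod_comp σ fun i => t - x i
  · rw [← Equiv.sum_comp σ fun i => Complex.normSq (w i) *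
      ∏ k ∈ Finset.univ.erase i, (t - x k)]
    refine Finset.sum_congr rfl fun i _ => ?_
    congr 1
    refine Finset.prod_equiv σ (fun k => ?_) fun k _ => rfl
    simp

/-- This is the trace identity for `diag(x) + w w^*` with `w i = √(weights x y i)`. It turns the
exponential density of the weights into a function of the two sums. -/
lemma sum_weights {n : ℕ} {x y : Fin n → ℝ} (hy : Interlaces x y) :
    ∑ i, weights x y i = ∑ i, y i - ∑ i, x i := by
  have hw : ∀ i, Complex.normSq ((√(weights x y i) : ℝ) : ℂ) = weights x y i :=
    fun i => normSq_sqrt (hy.weights_pos i).le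
  obtain ⟨σ, hσ⟩ := exists_perm_perturbedEigenvalues (w := fun i => ((√(weights x y i) : ℝ) : ℂ))
    hy hw
  have h := sum_perturbedEigenvalues x fun i => ((√(weights x y i) : ℝ) : ℂ)
  simp only [hw] at h
  have h2 : ∑ i, y i = ∑ k, perturbedEigenvalues x (fun i => ((√(weights x y i) : ℝ) : ℂ)) k := by
    rw [← Equiv.sum_comp σ (perturbedEigenvalues x _)]
    exact Finset.sum_congr rfl fun i _ => congrFun hσ i
  linarith

/-! ### The Jacobian -/

/-- The Vandermonde product. -/
noncomputable def vdm {n : ℕ} (x : Fin n → ℝ) : ℝ := ∏ j : Fin n, ∏ k ∈ Finset.Ioi j, (x k - x j)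

lemma vdm_pos {n : ℕ} {x : Fin n → ℝ} (hx : StrictMono x) : 0 < vdm x :=
  Finset.prod_pos fun _ _ => Finset.prod_pos fun _ hk => sub_pos.2 (hx (Finset.mem_Ioi.1 hk))

lemma abs_prod_prod_erase {n : ℕ} (x : Fin n → ℝ) :
    |∏ i, ∏ k ∈ Finset.univ.erase i, (x i - x k)| = |vdm x| ^ 2 := by
  have h1 : ∀ i : Fin n, Finset.univ.erase i = (Finset.Ioi i).disjUnion (Finset.Iio i)
      (Finset.disjoint_Ioi_Iio i) := by
    intro i; ext k; simp [lt_or_lt_iff_ne, eq_comm]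
  simp only [h1, Finset.prod_disjUnion, Finset.prod_mul_distrib, abs_mul, pow_two]
  have h2 : ∏ i, ∏ k ∈ Finset.Iio i, (x i - x k) = vdm x := by
    rw [vdm]
    exact Finset.prod_comm' (by simp)
  rw [h2]
  congr 1
  simp only [vdm, Finset.abs_prod]
  exact Finset.prod_congr rfl fun i _ => Finset.prod_congr rfl fun k _ => abs_sub_comm _ _

/-- A Cauchy determinant with denominators cleared. The matrix is the Vandermonde matrix of `x`
times the coefficient matrix `C` of the polynomials `∏_{l ≠ k} (X - y l)`. Replacing `x` by `y`
makes the product diagonal, which yields `|det C| = |Δ(y)|`. -/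
lemma abs_det_prod_erase {n : ℕ} {x y : Fin n → ℝ} (hy : Function.Injective y) :
    |(Matrix.of fun i k => ∏ l ∈ Finset.univ.erase k, (x i - y l)).det| = |vdm x| * |vdm y| := by
  let p : Fin n → Polynomial ℝ := fun k =>
    ∏ l ∈ Finset.univ.erase k, (Polynomial.X - Polynomial.C (y l))
  let C : Matrix (Fin n) (Fin n) ℝ := Matrix.of fun m k => (p k).coeff m
  have hp : ∀ k, (p k).natDegree < n := by
    intro k
    rw [Polynomial.natDegree_prod _ _ fun l _ => Polynomial.X_sub_C_ne_zero _]
    simp only [Polynomial.natDegree_X_sub_C, Finset.sum_const,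
      Finset.card_erase_of_mem (Finset.mem_univ k), Finset.card_univ, Fintype.card_fin,
      smul_eq_mul, mul_one]
    exact Nat.sub_lt k.pos one_pos
  have hV : ∀ u : Fin n → ℝ, Matrix.vandermonde u * C =
      Matrix.of fun i k => ∏ l ∈ Finset.univ.erase k, (u i - y l) := by
    intro u
    ext i k
    have : ∏ l ∈ Finset.univ.erase k, (u i - y l) = (p k).eval (u i) := by
      simp [p, Polynomial.eval_prod]
    rw [Matrix.of_apply, this, Polynomial.eval_eq_sum_range' (hp k), Matrix.mul_apply,
      Finset.sum_range]
    exact Finset.sum_congr rfl fun m _ => by simp [C, Matrix.vandermonde_apply, mul_comm]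
  have hdet : ∀ u : Fin n → ℝ, (Matrix.vandermonde u).det = vdm u := Matrix.det_vandermonde
  have hy0 : vdm y ≠ 0 := by rw [← hdet]; exact Matrix.det_vandermonde_ne_zero_iff.2 hy
  have hC : |vdm y| * |C.det| = |vdm y| ^ 2 := by
    rw [← abs_mul, ← hdet, ← Matrix.det_mul, hV, hdet, ← abs_prod_prod_erase, ← Matrix.det_diagonal]
    congr 2
    ext i k
    by_cases hik : i = k
    · subst hik; simp
    · rw [Matrix.of_apply, Matrix.diagonal_apply_ne _ hik]
      exact Finset.prod_eq_zero (Finset.mem_erase.2 ⟨hik, Finset.mem_univ i⟩) (sub_self _)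
  rw [← hV, Matrix.det_mul, abs_mul, hdet]
  congr 1
  have := abs_pos.2 hy0
  nlinarith

/-- The derivative of `weights x` at `y`. -/
noncomputable def weightsJacobian {n : ℕ} (x y : Fin n → ℝ) : Matrix (Fin n) (Fin n) ℝ :=
  Matrix.of fun i k => (∏ k ∈ Finset.univ.erase i, (x i - x k))⁻¹ *
    ∏ l ∈ Finset.univ.erase k, (x i - y l)

lemma hasFDerivAt_weights {n : ℕ} (x y : Fin n → ℝ) :
    HasFDerivAt (weights x) (LinearMap.toContinuousLinearMap
      (Matrix.toLin' (weightsJacobian x y))) y := by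
  refine hasFDerivAt_pi'.2 fun i => ?_
  have h1 : ∀ k ∈ Finset.univ, HasFDerivAt (fun y : Fin n → ℝ => x i - y k)
      (-(ContinuousLinearMap.proj k : (Fin n → ℝ) →L[ℝ] ℝ)) y := fun k _ =>
    (hasFDerivAt_apply k y).const_sub (x i)
  have h2 := (HasFDerivAt.finsetProd h1).neg.mul_const
    (∏ k ∈ Finset.univ.erase i, (x i - x k))⁻¹
  refine (h2.congr_fderiv ?_).congr_of_eventuallyEq (Filter.Eventually.of_forall fun z => ?_)
  · ext z
    simp only [smul_apply, neg_apply,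
      sum_apply, ContinuousLinearMap.comp_apply,
      ContinuousLinearMap.proj_apply, smul_eq_mul, LinearMap.coe_toContinuousLinearMap',
      Matrix.toLin'_apply, Matrix.mulVec, dotProduct, weightsJacobian, Matrix.of_apply]
    rw [← Finset.sum_neg_distrib, Finset.mul_sum]
    exact Finset.sum_congr rfl fun k _ => by ring
  · simp [weights, div_eq_mul_inv]

lemma abs_det_weightsJacobian {n : ℕ} {x y : Fin n → ℝ} (h : Interlaces x y) :
    |(weightsJacobian x y).det| = vdm y / vdm x := by
  have hx := vdm_pos h.strictMono_left
  have hy := vdm_pos h.strictMono_right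
  have : weightsJacobian x y = Matrix.diagonal
      (fun i => (∏ k ∈ Finset.univ.erase i, (x i - x k))⁻¹) *
        Matrix.of fun i k => ∏ l ∈ Finset.univ.erase k, (x i - y l) := by
    ext i k; simp [weightsJacobian]
  rw [this, Matrix.det_mul, Matrix.det_diagonal, abs_mul,
    abs_det_prod_erase h.strictMono_right.injective, Finset.prod_inv_distrib, abs_inv,
    abs_prod_prod_erase, abs_of_pos hx, abs_of_pos hy]
  field_simp

/-- The conditional law of the perturbed eigenvalues, tested against symmetric functions. -/
lemma lintegral_perturbedEigenvalues {n : ℕ} {x : Fin n → ℝ} (hx : StrictMono x)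
    {F : (Fin n → ℝ) → ℝ≥0∞} (hF : Measurable F)
    (hsymm : ∀ (σ : Equiv.Perm (Fin n)) y, F (y ∘ σ) = F y) :
    ∫⁻ w, F (perturbedEigenvalues x w) ∂complexGaussian n =
      ∫⁻ y in {y | Interlaces x y},
        ENNReal.ofReal (vdm y / vdm x * Real.exp (∑ i, x i - ∑ i, y i)) * F y := by
  -- Phases of `w` do not affect the eigenvalues, so the integrand is a function of the squared
  -- moduli, with `√a` as representative.
  let ψ : (Fin n → ℝ) → ℝ≥0∞ := fun a => F (perturbedEigenvalues x fun i => ((√(a i) : ℝ) : ℂ))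
  have hψm : Measurable ψ := by
    have h1 : Measurable fun (a : Fin n → ℝ) i => ((√(a i) : ℝ) : ℂ) := by fun_prop
    exact hF.comp (Measurable.perturbedEigenvalues (measurable_const (a := x)) h1)
  have hcm : Measurable fun (w : Fin n → ℂ) j => Complex.normSq (w j) :=
    measurable_pi_iff.2 fun j =>
      Complex.continuous_normSq.measurable.comp (measurable_pi_apply j)
  have hden : Measurable fun a : Fin n → ℝ => ENNReal.ofReal (∏ i, expDensity (a i)) := by
    have := measurable_expDensity
    fun_prop
  have h1 : ∀ w, F (perturbedEigenvalues x w) = ψ fun j => Complex.normSq (w j) := fun w =>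
    congrArg F (perturbedEigenvalues_congr x fun i => (normSq_sqrt (Complex.normSq_nonneg _)).symm)
  have hpos : MeasurableSet {a : Fin n → ℝ | ∀ i, 0 < a i} := by
    simp only [Set.ofPred_forall]
    exact MeasurableSet.iInter fun i => measurableSet_lt measurable_const (measurable_pi_apply i)
  have hI : MeasurableSet {y | Interlaces x y} :=
    measurableSet_interlaces.preimage measurable_prodMk_left
  simp only [h1]
  rw [← lintegral_map hψm hcm, map_normSq_complexGaussian,
    lintegral_withDensity_eq_lintegral_mul _ hden hψm]
  have h2 : ∀ a : Fin n → ℝ, ((fun a : Fin n → ℝ => ENNReal.ofReal (∏ i, expDensity (a i))) * ψ) a =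
      {a : Fin n → ℝ | ∀ i, 0 < a i}.indicator
        (fun a : Fin n → ℝ => ENNReal.ofReal (Real.exp (-∑ i, a i)) * ψ a) a := by
    intro a
    by_cases ha : ∀ i, 0 < a i
    · rw [Set.indicator_of_mem (by exact ha), Pi.mul_apply, ← Finset.sum_neg_distrib, Real.exp_sum]
      congr 2
      exact Finset.prod_congr rfl fun i _ => Set.indicator_of_mem (ha i) _
    · rw [Set.indicator_of_notMem (by exact ha), Pi.mul_apply]
      obtain ⟨i, hi⟩ := not_forall.1 ha
      rw [Finset.prod_eq_zero (Finset.mem_univ i) (Set.indicator_of_notMem hi _),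
        ENNReal.ofReal_zero, zero_mul]
  simp only [h2]
  rw [lintegral_indicator hpos, ← image_weights hx, lintegral_image_eq_lintegral_abs_det_fderiv_mul
    volume hI (fun y _ => (hasFDerivAt_weights x y).hasFDerivWithinAt) (injOn_weights hx)]
  refine setLIntegral_congr_fun hI fun y hy => ?_
  have hdet : |(LinearMap.toContinuousLinearMap (Matrix.toLin' (weightsJacobian x y))).det| =
      vdm y / vdm x := by
    rw [← abs_det_weightsJacobian hy, ← LinearMap.det_toLin']; rfl
  obtain ⟨σ, hσ⟩ := exists_perm_perturbedEigenvalues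
    (w := fun i => ((√(weights x y i) : ℝ) : ℂ)) hy
    fun i => normSq_sqrt (Interlaces.weights_pos hy i).le
  have hFy : ψ (weights x y) = F y := by
    conv_rhs => rw [hσ, hsymm]
  have hv := div_pos (vdm_pos (Interlaces.strictMono_right hy)) (vdm_pos hx)
  simp only [hdet]
  rw [hFy, ← mul_assoc, ← ENNReal.ofReal_mul hv.le, sum_weights hy, neg_sub]

/-! ### Symmetric functions and random relabelling -/

lemma measurePreserving_comp_perm {n : ℕ} (σ : Equiv.Perm (Fin n)) :
    MeasurePreserving (fun x : Fin n → ℝ => x ∘ σ) volume volume ∧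
      MeasurableEmbedding (fun x : Fin n → ℝ => x ∘ σ) := by
  have h : (fun x : Fin n → ℝ => x ∘ σ) =
      MeasurableEquiv.piCongrLeft (fun _ : Fin n => ℝ) σ.symm := by
    funext x
    rw [MeasurableEquiv.coe_piCongrLeft]
    funext i
    obtain ⟨j, rfl⟩ := σ.symm.surjective i
    rw [Equiv.piCongrLeft_apply_apply]
    simp
  rw [h]
  exact ⟨volume_measurePreserving_piCongrLeft (fun _ : Fin n => ℝ) σ.symm,
    MeasurableEquiv.measurableEmbedding _⟩

lemma measurableSet_strictMono {n : ℕ} : MeasurableSet {x : Fin n → ℝ | StrictMono x} := by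
  simp only [StrictMono, Set.ofPred_forall]
  refine MeasurableSet.iInter fun i => MeasurableSet.iInter fun j => MeasurableSet.iInter fun _ => ?_
  exact measurableSet_lt (measurable_pi_apply i) (measurable_pi_apply j)

/-- The integral of a symmetric function is determined by the increasing vectors. -/
lemma lintegral_eq_factorial_mul {n : ℕ} {h : (Fin n → ℝ) → ℝ≥0∞}
    (hsymm : ∀ (σ : Equiv.Perm (Fin n)) x, h (x ∘ σ) = h x)
    (hzero : ∀ x, ¬ Function.Injective x → h x = 0) :
    ∫⁻ x, h x = (n ! : ℕ) * ∫⁻ x in {x | StrictMono x}, h x := by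
  let s : Equiv.Perm (Fin n) → Set (Fin n → ℝ) := fun σ => (fun x => x ∘ σ) ⁻¹' {x | StrictMono x}
  have hs : ∀ σ, MeasurableSet (s σ) := fun σ =>
    measurableSet_strictMono.preimage (measurePreserving_comp_perm σ).1.measurable
  have hd : Pairwise (Function.onFun Disjoint s) := by
    intro σ τ hστ
    refine Set.disjoint_left.2 fun x hx hx' => hστ ?_
    have h1 : StrictMono (x ∘ σ) := hx
    have h2 : StrictMono (x ∘ τ) := hx'
    have h3 : x ∘ σ = x ∘ τ := (h1.range_inj h2).1 (by
      rw [σ.surjective.range_comp, τ.surjective.range_comp])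
    have hinj : Function.Injective x := by
      have := h1.injective.comp σ.symm.injective
      rwa [Function.comp_assoc, Equiv.self_comp_symm, Function.comp_id] at this
    exact Equiv.ext fun i => hinj (congrFun h3 i)
  have hind : ∀ x, h x = (⋃ σ, s σ).indicator h x := by
    intro x
    by_cases hx : x ∈ ⋃ σ, s σ
    · rw [Set.indicator_of_mem hx]
    · rw [Set.indicator_of_notMem hx]
      -- A vector with distinct coordinates is made strictly increasing by its sorting permutation,
      -- so the chambers miss only vectors with a repetition.
      refine hzero x fun hinj => hx ?_
      refine Set.mem_iUnion.2 ⟨Tuple.sort x, ?_⟩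
      exact (Tuple.monotone_sort x).strictMono_of_injective
        (hinj.comp (Tuple.sort x).injective)
  rw [lintegral_congr hind, lintegral_indicator (MeasurableSet.iUnion hs), lintegral_iUnion hs hd,
    tsum_fintype]
  have heach : ∀ σ, ∫⁻ x in s σ, h x = ∫⁻ x in {x | StrictMono x}, h x := by
    intro σ
    rw [← (measurePreserving_comp_perm σ).1.setLIntegral_comp_preimage_emb
      (measurePreserving_comp_perm σ).2 h {x | StrictMono x}]
    simp only [hsymm]
    rfl
  simp only [heach, Finset.sum_const, Finset.card_univ, Fintype.card_perm, Fintype.card_fin,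
    nsmul_eq_mul]

/-- The average of a function over all relabellings. -/
noncomputable def symmetrize {n : ℕ} (h : (Fin n → ℝ) → ℝ≥0∞) (x : Fin n → ℝ) : ℝ≥0∞ :=
  ((n ! : ℕ) : ℝ≥0∞)⁻¹ * ∑ σ : Equiv.Perm (Fin n), h (x ∘ σ)

lemma symmetrize_comp_perm {n : ℕ} (h : (Fin n → ℝ) → ℝ≥0∞) (τ : Equiv.Perm (Fin n))
    (x : Fin n → ℝ) : symmetrize h (x ∘ τ) = symmetrize h x := by
  unfold symmetrize
  congr 1
  rw [← Equiv.sum_comp (Equiv.mulLeft τ) fun σ => h (x ∘ σ)]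
  rfl

lemma inv_factorial_mul_factorial (n : ℕ) :
    ((n ! : ℕ) : ℝ≥0∞)⁻¹ * (n ! : ℕ) = 1 :=
  ENNReal.inv_mul_cancel (by exact_mod_cast n.factorial_ne_zero) (ENNReal.natCast_ne_top _)

lemma symmetrize_eq_self {n : ℕ} {h : (Fin n → ℝ) → ℝ≥0∞}
    (hsymm : ∀ (σ : Equiv.Perm (Fin n)) x, h (x ∘ σ) = h x) : symmetrize h = h := by
  funext x
  simp only [symmetrize, hsymm, Finset.sum_const, Finset.card_univ, Fintype.card_perm,
    Fintype.card_fin, nsmul_eq_mul]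
  rw [← mul_assoc, inv_factorial_mul_factorial, one_mul]

lemma measurable_comp_perm {n : ℕ} (σ : Equiv.Perm (Fin n)) :
    Measurable fun x : Fin n → ℝ => x ∘ σ := (measurePreserving_comp_perm σ).1.measurable

lemma measurable_symmetrize {n : ℕ} {h : (Fin n → ℝ) → ℝ≥0∞} (hm : Measurable h) :
    Measurable (symmetrize h) :=
  (Finset.measurable_fun_sum _ fun σ _ => hm.comp (measurable_comp_perm σ)).const_mul _

lemma lintegral_unorderedLaw {Ω : Type*} [MeasurableSpace Ω] {P : Measure Ω} {n : ℕ}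
    {y : Ω → Fin n → ℝ} (hy : AEMeasurable y P) {h : (Fin n → ℝ) → ℝ≥0∞} (hm : Measurable h) :
    ∫⁻ z, h z ∂unorderedLaw P y = ∫⁻ ω, symmetrize h (y ω) ∂P := by
  have hmap : ∀ σ : Equiv.Perm (Fin n), ∫⁻ z, h z ∂(P.map fun ω j => y ω (σ j)) =
      ∫⁻ ω, h (y ω ∘ σ) ∂P := fun σ =>
    lintegral_map' hm.aemeasurable ((measurable_comp_perm σ).comp_aemeasurable hy)
  rw [unorderedLaw, lintegral_smul_measure, lintegral_finsetSum_measure, smul_eq_mul]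
  have hae : ∀ σ : Equiv.Perm (Fin n), AEMeasurable (fun ω => h (y ω ∘ σ)) P := fun σ =>
    (hm.comp (measurable_comp_perm σ)).comp_aemeasurable hy
  simp only [hmap]
  rw [← lintegral_finsetSum' _ fun σ _ => hae σ, ← lintegral_const_mul'' _
    (Finset.aemeasurable_fun_sum _ fun σ _ => hae σ)]
  rfl

/-- Relabelling preserves Lebesgue measure and `D`, so every term of the average has the same
integral. -/
lemma lintegral_symmetrize_mul {n : ℕ} {h D : (Fin n → ℝ) → ℝ≥0∞} (hm : Measurable h)
    (hD : AEMeasurable D) (hsymm : ∀ (σ : Equiv.Perm (Fin n)) x, D (x ∘ σ) = D x) :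
    ∫⁻ x, symmetrize h x * D x = ∫⁻ x, h x * D x := by
  have heach : ∀ σ : Equiv.Perm (Fin n), ∫⁻ x, h (x ∘ σ) * D x = ∫⁻ x, h x * D x := by
    intro σ
    rw [← (measurePreserving_comp_perm σ).1.lintegral_comp_emb (measurePreserving_comp_perm σ).2
      fun x => h x * D x]
    simp only [hsymm]
  have hae : ∀ σ : Equiv.Perm (Fin n), AEMeasurable fun x => h (x ∘ σ) * D x := fun σ =>
    (hm.comp (measurable_comp_perm σ)).aemeasurable.mul hD
  simp only [symmetrize, mul_assoc, Finset.sum_mul]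
  rw [lintegral_const_mul'' _ (Finset.aemeasurable_fun_sum _ fun σ _ => hae σ),
    lintegral_finsetSum' _ fun σ _ => hae σ]
  simp only [heach, Finset.sum_const, Finset.card_univ, Fintype.card_perm, Fintype.card_fin,
    nsmul_eq_mul]
  rw [← mul_assoc, inv_factorial_mul_factorial, one_mul]

lemma polynomialEnsembleDensity_eq {n : ℕ} (f : Fin n → ℝ → ℝ) (Z : ℝ) (x : Fin n → ℝ) :
    polynomialEnsembleDensity f Z x =
      1 / Z * vdm x * (Matrix.of fun j k : Fin n => f k (x j)).det := rfl

lemma vdm_comp_perm {n : ℕ} (σ : Equiv.Perm (Fin n)) (x : Fin n → ℝ) :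
    vdm (x ∘ σ) = Equiv.Perm.sign σ * vdm x := by
  rw [vdm, vdm, ← Matrix.det_vandermonde, ← Matrix.det_vandermonde, ← Matrix.det_permute]
  rfl

/-- The Vandermonde product and the determinant both pick up the sign of `σ`. -/
lemma polynomialEnsembleDensity_comp_perm {n : ℕ} (f : Fin n → ℝ → ℝ) (Z : ℝ)
    (σ : Equiv.Perm (Fin n)) (x : Fin n → ℝ) :
    polynomialEnsembleDensity f Z (x ∘ σ) = polynomialEnsembleDensity f Z x := by
  have h : (Matrix.of fun j k : Fin n => f k ((x ∘ σ) j)).det =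
      Equiv.Perm.sign σ * (Matrix.of fun j k : Fin n => f k (x j)).det := by
    rw [← Matrix.det_permute]; rfl
  have hs : ((Equiv.Perm.sign σ : ℤ) : ℝ) * ((Equiv.Perm.sign σ : ℤ) : ℝ) = 1 := by
    rw [← Int.cast_mul, ← Units.val_mul, Int.units_mul_self]; simp
  rw [polynomialEnsembleDensity_eq, polynomialEnsembleDensity_eq, h, vdm_comp_perm]
  linear_combination (1 / Z * vdm x * (Matrix.of fun j k : Fin n => f k (x j)).det) * hs

lemma polynomialEnsembleDensity_of_not_injective {n : ℕ} (f : Fin n → ℝ → ℝ) (Z : ℝ)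
    {x : Fin n → ℝ} (hx : ¬ Function.Injective x) : polynomialEnsembleDensity f Z x = 0 := by
  have : vdm x = 0 := by
    rw [vdm, ← Matrix.det_vandermonde]
    by_contra h
    exact hx (Matrix.det_vandermonde_ne_zero_iff.1 h)
  rw [polynomialEnsembleDensity_eq, this, mul_zero, zero_mul]

/-! ### Integration over interlacing points -/

/-- The primitive of `e^s h(s)` that vanishes at `-∞`. -/
noncomputable def expPrimitive (h : ℝ → ℝ) (y : ℝ) : ℝ := ∫ s in Set.Iio y, Real.exp s * h s

lemma integrableOn_exp_mul {h : ℝ → ℝ} (hh : Integrable h) (y : ℝ) :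
    IntegrableOn (fun s => Real.exp s * h s) (Set.Iio y) := by
  refine Integrable.mono' ((hh.norm.const_mul (Real.exp y)).integrableOn)
    (Real.continuous_exp.aestronglyMeasurable.mul hh.1.restrict) ?_
  refine (ae_restrict_mem measurableSet_Iio).mono fun s hs => ?_
  rw [norm_mul, Real.norm_eq_abs, abs_of_pos (Real.exp_pos s)]
  exact mul_le_mul_of_nonneg_right (Real.exp_le_exp.2 (le_of_lt hs)) (norm_nonneg _)

/-- The interval of the `i`-th coordinate of the vectors interlacing with `y`. -/
def interlacingInterval {n : ℕ} (y : Fin n → ℝ) (i : Fin n) : Set ℝ :=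
  {t | t < y i ∧ ∀ j, j < i → y j < t}

lemma interlacingInterval_subset {n : ℕ} (y : Fin n → ℝ) (i : Fin n) :
    interlacingInterval y i ⊆ Set.Iio (y i) := fun _ h => h.1

lemma setOf_interlaces_eq_pi {n : ℕ} (y : Fin n → ℝ) :
    {x | Interlaces x y} = Set.univ.pi (interlacingInterval y) := by
  ext x
  constructor
  · exact fun h i _ => ⟨h.1 i, fun j hj => h.2 j i hj⟩
  · exact fun h => ⟨fun i => (h i trivial).1, fun i j hij => (h j trivial).2 i hij⟩

/-- The intervals are `(-∞, y_1)`, `(y_1, y_2)`, and so on, so each later row on the left is the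
difference of two consecutive rows on the right. -/
lemma det_interlacingInterval_eq {n : ℕ} {f : Fin n → ℝ → ℝ} (hf : ∀ k, Integrable (f k))
    {y : Fin n → ℝ} (hy : StrictMono y) :
    (Matrix.of fun i k => ∫ s in interlacingInterval y i, Real.exp s * f k s).det =
      (Matrix.of fun i k => expPrimitive (f k) (y i)).det := by
  cases n with
  | zero => simp
  | succ m =>
    symm
    refine Matrix.det_eq_of_forall_row_eq_smul_add_pred (fun _ => 1) (fun k => ?_) fun i k => ?_
    · have : interlacingInterval y 0 = Set.Iio (y 0) := by
        ext t; simp [interlacingInterval]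
      simp [expPrimitive, this]
    · have hlt : y i.castSucc < y i.succ := hy i.castSucc_lt_succ
      have : interlacingInterval y i.succ = Set.Ioo (y i.castSucc) (y i.succ) := by
        ext t
        constructor
        · exact fun h => ⟨h.2 _ i.castSucc_lt_succ, h.1⟩
        · refine fun h => ⟨h.2, fun j hj => (hy.monotone ?_).trans_lt h.1⟩
          exact Fin.le_castSucc_iff.2 hj
      have hun : Set.Iio (y i.succ) = Set.Ioo (y i.castSucc) (y i.succ) ∪ Set.Iic (y i.castSucc) := by
        rw [Set.union_comm, Set.Iic_union_Ioo_eq_Iio hlt]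
      have hint := integrableOn_exp_mul (hf k) (y i.succ)
      rw [hun] at hint
      have hdisj : Disjoint (Set.Ioo (y i.castSucc) (y i.succ)) (Set.Iic (y i.castSucc)) :=
        Set.disjoint_left.2 fun t h1 h2 => not_lt.2 h2 h1.1
      simp only [Matrix.of_apply, one_mul, this, expPrimitive]
      rw [← integral_Iic_eq_integral_Iio (x := y i.castSucc), hun,
        setIntegral_union hdisj measurableSet_Iic hint.left_of_union hint.right_of_union]

/-- The domain is a box and each term of the Leibniz expansion is a product of one-variable
functions, so integration passes inside the determinant. -/
lemma integral_interlaces {n : ℕ} {f : Fin n → ℝ → ℝ} (hf : ∀ k, Integrable (f k))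
    {y : Fin n → ℝ} (hy : StrictMono y) :
    IntegrableOn (fun x : Fin n → ℝ => Real.exp (∑ i, x i) * (Matrix.of fun j k => f k (x j)).det)
        {x | Interlaces x y} ∧
      ∫ x in {x | Interlaces x y},
          Real.exp (∑ i, x i) * (Matrix.of fun j k => f k (x j)).det =
        (Matrix.of fun i k => expPrimitive (f k) (y i)).det := by
  have hexp : ∀ x : Fin n → ℝ, Real.exp (∑ i, x i) * (Matrix.of fun j k => f k (x j)).det =
      ∑ σ : Equiv.Perm (Fin n), ((Equiv.Perm.sign σ : ℤ) : ℝ) *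
        ∏ i, (Real.exp (x i) * f (σ i) (x i)) := by
    intro x
    rw [Real.exp_sum, ← Matrix.det_mul_column, ← Matrix.det_transpose, Matrix.det_apply']
    rfl
  have hint : ∀ i k, Integrable (fun s => Real.exp s * f k s)
      (volume.restrict (interlacingInterval y i)) := fun i k =>
    (integrableOn_exp_mul (hf k) (y i)).mono_set (interlacingInterval_subset y i)
  have hprod : ∀ σ : Equiv.Perm (Fin n), Integrable (fun x : Fin n → ℝ =>
      ((Equiv.Perm.sign σ : ℤ) : ℝ) * ∏ i, (Real.exp (x i) * f (σ i) (x i)))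
      (Measure.pi fun i => volume.restrict (interlacingInterval y i)) := fun σ =>
    (Integrable.fintype_prod_dep fun i => hint i (σ i)).const_mul _
  rw [setOf_interlaces_eq_pi, IntegrableOn, volume_pi, Measure.restrict_pi_pi]
  simp only [hexp]
  refine ⟨integrable_finsetSum _ fun σ _ => hprod σ, ?_⟩
  rw [integral_finsetSum _ fun σ _ => hprod σ, ← det_interlacingInterval_eq hf hy,
    ← Matrix.det_transpose, Matrix.det_apply']
  refine Finset.sum_congr rfl fun σ _ => ?_
  rw [integral_const_mul, integral_fintype_prod_eq_prod
    (f := fun i s => Real.exp s * f (σ i) s)]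
  rfl

/-! ### The convolved functions -/

/-- The function `g(y) = ∫_0^y e^{-x} h(y - x) dx`. -/
noncomputable def expConvolution (h : ℝ → ℝ) (y : ℝ) : ℝ :=
  ∫ x in (0 : ℝ)..y, Real.exp (-x) * h (y - x)

lemma expConvolution_eq_integral {h : ℝ → ℝ} (hh : ∀ x, x < 0 → h x = 0) (y : ℝ) :
    expConvolution h y = ∫ u, expDensity u * h (y - u) := by
  have h1 : ∫ u, expDensity u * h (y - u) =
      ∫ u in Set.Ioi (0 : ℝ), Real.exp (-u) * h (y - u) := by
    rw [← integral_indicator measurableSet_Ioi]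
    refine integral_congr_ae (Filter.Eventually.of_forall fun u => ?_)
    by_cases hu : u ∈ Set.Ioi (0 : ℝ) <;> simp [expDensity, hu]
  rw [h1, expConvolution]
  rcases le_or_gt 0 y with hy | hy
  · rw [intervalIntegral.integral_of_le hy]
    refine (setIntegral_eq_of_subset_of_forall_sdiff_eq_zero measurableSet_Ioi
      Set.Ioc_subset_Ioi_self fun u hu => ?_).symm
    have : y < u := not_le.1 fun h => hu.2 ⟨hu.1, h⟩
    rw [hh _ (by linarith), mul_zero]
  -- For `y < 0` both integrals vanish, since `y - u < 0` at every point of integration.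
  · rw [intervalIntegral.integral_of_ge hy.le, integral_Ioc_eq_integral_Ioo,
      setIntegral_eq_zero_of_forall_eq_zero, setIntegral_eq_zero_of_forall_eq_zero, neg_zero]
    · intro u hu
      rw [hh _ (by linarith [Set.mem_Ioi.1 hu]), mul_zero]
    · intro u hu
      rw [hh _ (by linarith [hu.1]), mul_zero]

lemma expConvolution_eq_expPrimitive {h : ℝ → ℝ} (hh : ∀ x, x < 0 → h x = 0) (y : ℝ) :
    expConvolution h y = Real.exp (-y) * expPrimitive h y := by
  rw [expConvolution_eq_integral hh, expPrimitive, ← integral_const_mul,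
    ← integral_indicator measurableSet_Iio,
    ← integral_sub_left_eq_self (fun u => expDensity u * h (y - u)) volume y]
  refine integral_congr_ae (Filter.Eventually.of_forall fun s => ?_)
  by_cases hs : s < y
  · have h1 : y - s ∈ Set.Ioi (0 : ℝ) := sub_pos.2 hs
    simp only [expDensity, Set.indicator_of_mem h1, Set.indicator_of_mem (Set.mem_Iio.2 hs)]
    rw [← mul_assoc, ← Real.exp_add]
    congr 2
    · ring
    · ring
  · have h1 : y - s ∉ Set.Ioi (0 : ℝ) := fun h => hs (sub_pos.1 h)
    simp [expDensity, hs]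

lemma integrable_pow_mul_expDensity (i : ℕ) : Integrable fun u => u ^ i * expDensity u := by
  have h := Real.GammaIntegral_convergent (s := i + 1) (by positivity)
  refine ((integrable_indicator_iff measurableSet_Ioi).2 h).congr
    (Filter.Eventually.of_forall fun u => ?_)
  by_cases hu : u ∈ Set.Ioi (0 : ℝ)
  · simp [expDensity, hu, mul_comm]
  · simp [expDensity, hu]

/-- Expanding `y^j = (u + (y - u))^j` binomially writes the function, almost everywhere, as a
combination of convolutions of integrable functions. -/
lemma integrable_pow_mul_expConvolution {h : ℝ → ℝ} (hh : ∀ x, x < 0 → h x = 0) (j : ℕ)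
    (hint : ∀ i ≤ j, Integrable fun x => x ^ i * h x) :
    Integrable fun y => y ^ j * expConvolution h y := by
  let L := ContinuousLinearMap.mul ℝ ℝ
  let F : ℕ → ℝ → ℝ := fun i => convolution (fun u => u ^ i * expDensity u)
    (fun x => x ^ (j - i) * h x) L volume
  have hi : ∀ i, Integrable fun x => x ^ (j - i) * h x := fun i => hint _ (Nat.sub_le j i)
  have hF : ∀ i, Integrable (F i) := fun i =>
    (integrable_pow_mul_expDensity i).integrable_convolution L (hi i)
  have hsum : Integrable fun y => ∑ i ∈ Finset.range (j + 1), (j.choose i : ℝ) * F i y :=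
    integrable_finsetSum _ fun i _ => (hF i).const_mul _
  refine hsum.congr ?_
  have hex : ∀ᵐ y, ∀ i, ConvolutionExistsAt (fun u => u ^ i * expDensity u)
      (fun x => x ^ (j - i) * h x) y L volume :=
    ae_all_iff.2 fun i => (integrable_pow_mul_expDensity i).ae_convolution_exists L (hi i)
  filter_upwards [hex] with y hy
  have hy' : ∀ i, Integrable fun u => u ^ i * expDensity u * ((y - u) ^ (j - i) * h (y - u)) := hy
  have hF' : ∀ i, F i y = ∫ u, u ^ i * expDensity u * ((y - u) ^ (j - i) * h (y - u)) :=
    fun i => rfl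
  rw [expConvolution_eq_integral hh, ← integral_const_mul]
  simp only [hF', ← integral_const_mul]
  rw [← integral_finsetSum _ fun i _ => (hy' i).const_mul _]
  refine integral_congr_ae (Filter.Eventually.of_forall fun u => ?_)
  have hb : y ^ j = ∑ i ∈ Finset.range (j + 1), u ^ i * (y - u) ^ (j - i) * (j.choose i : ℝ) := by
    rw [← add_pow]; ring_nf
  simp only [hb, Finset.sum_mul]
  exact Finset.sum_congr rfl fun i _ => by ring

/-! ### The law of the perturbed eigenvalues -/

lemma map_comp_perm_complexGaussian {n : ℕ} (σ : Equiv.Perm (Fin n)) :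
    (complexGaussian n).map (fun w => w ∘ σ) = complexGaussian n := by
  have h : (fun w : Fin n → ℂ => w ∘ σ) = (σ.permMatrix ℂ).mulVec := by
    funext w; rw [Matrix.permMatrix_mulVec]
  rw [h]
  refine map_mulVec_complexGaussian ?_
  rw [Matrix.star_eq_conjTranspose, Matrix.conjTranspose_permMatrix, ← Matrix.permMatrix_mul,
    inv_mul_cancel, Matrix.permMatrix_one]

/-- The expectation of `F` at the eigenvalues of `diag x + w w^*`, with `w` Gaussian. -/
noncomputable def perturbedExpectation {n : ℕ} (F : (Fin n → ℝ) → ℝ≥0∞) (x : Fin n → ℝ) : ℝ≥0∞ :=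
  ∫⁻ w, F (perturbedEigenvalues x w) ∂complexGaussian n

section

variable {n : ℕ} {F : (Fin n → ℝ) → ℝ≥0∞}

lemma measurable_perturbedExpectation (hF : Measurable F) :
    Measurable (perturbedExpectation F) := by
  have h : Measurable fun p : (Fin n → ℝ) × (Fin n → ℂ) => F (perturbedEigenvalues p.1 p.2) :=
    hF.comp (Measurable.perturbedEigenvalues measurable_fst measurable_snd)
  exact h.lintegral_prod_right

lemma lintegral_comp_mulVec (hF : Measurable F) (x : Fin n → ℝ)
    {U : Matrix (Fin n) (Fin n) ℂ} (hU : U * star U = 1) :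
    ∫⁻ w, F (perturbedEigenvalues x (U.mulVec w)) ∂complexGaussian n =
      perturbedExpectation F x := by
  have hUm : Measurable (U.mulVec) := (Continuous.matrix_mulVec continuous_const
    continuous_id).measurable
  have hm : Measurable fun w => F (perturbedEigenvalues x w) :=
    hF.comp (Measurable.perturbedEigenvalues (measurable_const (a := x)) measurable_id)
  rw [perturbedExpectation]
  conv_rhs => rw [← map_mulVec_complexGaussian hU]
  rw [lintegral_map hm hUm]

lemma perturbedExpectation_comp_perm (hF : Measurable F) (σ : Equiv.Perm (Fin n))
    (x : Fin n → ℝ) : perturbedExpectation F (x ∘ σ) = perturbedExpectation F x := by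
  have hσm : Measurable fun w : Fin n → ℂ => w ∘ σ :=
    measurable_pi_iff.2 fun i => measurable_pi_apply (σ i)
  have hm : Measurable fun w => F (perturbedEigenvalues (x ∘ σ) w) :=
    hF.comp (Measurable.perturbedEigenvalues (measurable_const (a := x ∘ σ)) measurable_id)
  rw [perturbedExpectation, ← map_comp_perm_complexGaussian σ, lintegral_map hm hσm]
  simp only [perturbedEigenvalues_comp_perm]
  rfl

end

section

variable {n : ℕ} {f : Fin n → ℝ → ℝ} {Z : ℝ}

/-- The density without the Vandermonde factor, tilted by the exponential of the sum. -/
noncomputable def tiltedDet (f : Fin n → ℝ → ℝ) (Z : ℝ) (x : Fin n → ℝ) : ℝ :=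
  1 / Z * (Real.exp (∑ i, x i) * (Matrix.of fun j k => f k (x j)).det)

lemma polynomialEnsembleDensity_eq_tiltedDet (x : Fin n → ℝ) :
    polynomialEnsembleDensity f Z x = vdm x * Real.exp (-∑ i, x i) * tiltedDet f Z x := by
  rw [polynomialEnsembleDensity_eq, tiltedDet, Real.exp_neg]
  have := (Real.exp_pos (∑ i, x i)).ne'
  field_simp

lemma tiltedDet_nonneg (h0 : ∀ x, 0 ≤ polynomialEnsembleDensity f Z x) {x : Fin n → ℝ}
    (hx : StrictMono x) : 0 ≤ tiltedDet f Z x := by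
  have h := h0 x
  rw [polynomialEnsembleDensity_eq_tiltedDet] at h
  exact nonneg_of_mul_nonneg_right h (mul_pos (vdm_pos hx) (Real.exp_pos _))

lemma aemeasurable_det (hf : ∀ k, AEMeasurable (f k)) :
    AEMeasurable fun x : Fin n → ℝ => (Matrix.of fun j k => f k (x j)).det := by
  have h : ∀ j k, AEMeasurable fun x : Fin n → ℝ => f k (x j) := fun j k =>
    (hf k).comp_quasiMeasurePreserving (Measure.quasiMeasurePreserving_eval _ j)
  simp only [Matrix.det_apply', Matrix.of_apply]
  exact Finset.aemeasurable_fun_sum _ fun σ _ =>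
    (Finset.aemeasurable_fun_prod _ fun i _ => h (σ i) i).const_mul _

lemma aemeasurable_tiltedDet (hf : ∀ k, AEMeasurable (f k)) : AEMeasurable (tiltedDet f Z) := by
  have hm : Measurable fun x : Fin n → ℝ => Real.exp (∑ i, x i) := by fun_prop
  exact (hm.aemeasurable.mul (aemeasurable_det hf)).const_mul _

lemma measurable_vdm : Measurable (vdm (n := n)) := by unfold vdm; fun_prop

lemma aemeasurable_polynomialEnsembleDensity (hf : ∀ k, AEMeasurable (f k)) :
    AEMeasurable (polynomialEnsembleDensity f Z) :=
  (measurable_vdm.const_mul (1 / Z)).aemeasurable.mul (aemeasurable_det hf)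

lemma polynomialEnsembleDensity_expConvolution (hneg : ∀ k x, x < 0 → f k x = 0)
    (hf : ∀ k, Integrable (f k)) {y : Fin n → ℝ} (hy : StrictMono y) :
    polynomialEnsembleDensity (fun k => expConvolution (f k)) Z y =
      vdm y * Real.exp (-∑ i, y i) * ∫ x in {x | Interlaces x y}, tiltedDet f Z x := by
  have h : (Matrix.of fun j k => expConvolution (f k) (y j)).det =
      Real.exp (-∑ i, y i) * (Matrix.of fun j k => expPrimitive (f k) (y j)).det := by
    rw [← Finset.sum_neg_distrib, Real.exp_sum, ← Matrix.det_mul_column]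
    simp only [expConvolution_eq_expPrimitive (hneg _)]
    rfl
  simp only [tiltedDet]
  rw [polynomialEnsembleDensity_eq, h, integral_const_mul, (integral_interlaces hf hy).2]
  ring

lemma polynomialEnsembleDensity_expConvolution_nonneg (hneg : ∀ k x, x < 0 → f k x = 0)
    (hf : ∀ k, Integrable (f k)) (h0 : ∀ x, 0 ≤ polynomialEnsembleDensity f Z x)
    (y : Fin n → ℝ) : 0 ≤ polynomialEnsembleDensity (fun k => expConvolution (f k)) Z y := by
  by_cases hinj : Function.Injective y
  · have hs : StrictMono (y ∘ Tuple.sort y) :=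
      (Tuple.monotone_sort y).strictMono_of_injective (hinj.comp (Tuple.sort y).injective)
    -- The integral formula is available only for increasing vectors; symmetry moves `y` there.
    rw [← polynomialEnsembleDensity_comp_perm _ _ (Tuple.sort y),
      polynomialEnsembleDensity_expConvolution hneg hf hs]
    refine mul_nonneg (mul_pos (vdm_pos hs) (Real.exp_pos _)).le
      (setIntegral_nonneg ?_ fun x hx => tiltedDet_nonneg h0 (Interlaces.strictMono_left hx))
    exact measurableSet_interlaces.preimage measurable_prodMk_right
  · rw [polynomialEnsembleDensity_of_not_injective _ _ hinj]

/-- After restriction to increasing vectors, both sides are iterated integrals of one nonnegative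
kernel on interlacing pairs, so Tonelli's theorem identifies them. -/
lemma lintegral_perturbedExpectation_mul (hneg : ∀ k x, x < 0 → f k x = 0)
    (hf : ∀ k, Integrable (f k)) (h0 : ∀ x, 0 ≤ polynomialEnsembleDensity f Z x)
    {F : (Fin n → ℝ) → ℝ≥0∞} (hF : Measurable F)
    (hsymm : ∀ (σ : Equiv.Perm (Fin n)) y, F (y ∘ σ) = F y) :
    ∫⁻ x, perturbedExpectation F x * ENNReal.ofReal (polynomialEnsembleDensity f Z x) =
      ∫⁻ y, F y * ENNReal.ofReal
        (polynomialEnsembleDensity (fun k => expConvolution (f k)) Z y) := by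
  have hm : ∀ k, AEMeasurable (f k) := fun k => (hf k).1.aemeasurable
  rw [lintegral_eq_factorial_mul (fun σ x => by
      rw [perturbedExpectation_comp_perm hF, polynomialEnsembleDensity_comp_perm])
      (fun x hx => by
        rw [polynomialEnsembleDensity_of_not_injective _ _ hx, ENNReal.ofReal_zero, mul_zero]),
    lintegral_eq_factorial_mul (fun σ x => by
      rw [hsymm, polynomialEnsembleDensity_comp_perm])
      (fun x hx => by
        rw [polynomialEnsembleDensity_of_not_injective _ _ hx, ENNReal.ofReal_zero, mul_zero])]
  congr 1
  rw [← lintegral_indicator measurableSet_strictMono, ← lintegral_indicator measurableSet_strictMono]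
  let a : (Fin n → ℝ) → ℝ≥0∞ := fun y => ENNReal.ofReal (vdm y * Real.exp (-∑ i, y i)) * F y
  let b : (Fin n → ℝ) → ℝ≥0∞ := fun x => ENNReal.ofReal (tiltedDet f Z x)
  let I : Set ((Fin n → ℝ) × (Fin n → ℝ)) := {p | Interlaces p.1 p.2}
  have ha : Measurable a := by
    have := measurable_vdm (n := n)
    fun_prop
  have hb : AEMeasurable b := (aemeasurable_tiltedDet hm).ennreal_ofReal
  have hIx : ∀ x : Fin n → ℝ, MeasurableSet {y | Interlaces x y} := fun x =>
    measurableSet_interlaces.preimage measurable_prodMk_left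
  have hIy : ∀ y : Fin n → ℝ, MeasurableSet {x | Interlaces x y} := fun y =>
    measurableSet_interlaces.preimage measurable_prodMk_right
  -- Once `Δ(x)` has cancelled, the joint density on interlacing pairs splits into a factor in `y`
  -- and a factor in `x`.
  let K : (Fin n → ℝ) → (Fin n → ℝ) → ℝ≥0∞ := fun x y => I.indicator (fun p => a p.2 * b p.1) (x, y)
  have hK : AEMeasurable (Function.uncurry K) (volume.prod volume) := by
    refine AEMeasurable.indicator ?_ measurableSet_interlaces
    exact (ha.comp measurable_snd).aemeasurable.mul
      (hb.comp_quasiMeasurePreserving Measure.quasiMeasurePreserving_fst)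
  have hleft : ∀ x, {x : Fin n → ℝ | StrictMono x}.indicator (fun x => perturbedExpectation F x *
      ENNReal.ofReal (polynomialEnsembleDensity f Z x)) x = ∫⁻ y, K x y := by
    intro x
    by_cases hx : StrictMono x
    · have hKx : ∀ y, K x y = {y | Interlaces x y}.indicator (fun y => a y * b x) y := fun y => rfl
      rw [Set.indicator_of_mem (by exact hx), lintegral_congr hKx, lintegral_indicator (hIx x),
        perturbedExpectation, lintegral_perturbedEigenvalues hx hF hsymm,
        ← lintegral_mul_const' _ _ ENNReal.ofReal_ne_top]
      refine setLIntegral_congr_fun (hIx x) fun y hy => ?_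
      have hvx := vdm_pos hx
      have hvy := vdm_pos (Interlaces.strictMono_right hy)
      have ht := tiltedDet_nonneg h0 hx
      simp only [a, b]
      rw [mul_right_comm, ← ENNReal.ofReal_mul (by positivity),
        mul_right_comm (ENNReal.ofReal _) (F y), ← ENNReal.ofReal_mul (by positivity), polynomialEnsembleDensity_eq_tiltedDet]
      congr 2
      rw [sub_eq_add_neg, Real.exp_add, Real.exp_neg (∑ i, x i)]
      have := (Real.exp_pos (∑ i, x i)).ne'
      field_simp
    · rw [Set.indicator_of_notMem (by exact hx)]
      have : ∀ y, K x y = 0 := fun y =>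
        Set.indicator_of_notMem (s := I) (a := (x, y))
          (fun h => hx (Interlaces.strictMono_left h)) _
      simp [this]
  have hright : ∀ y, {y : Fin n → ℝ | StrictMono y}.indicator (fun y => F y * ENNReal.ofReal
      (polynomialEnsembleDensity (fun k => expConvolution (f k)) Z y)) y = ∫⁻ x, K x y := by
    intro y
    by_cases hy : StrictMono y
    · have hKy : ∀ x, K x y = {x | Interlaces x y}.indicator (fun x => a y * b x) x := fun x => rfl
      rw [Set.indicator_of_mem (by exact hy), lintegral_congr hKy, lintegral_indicator (hIy y),
        lintegral_const_mul'' _ hb.restrict, ← ofReal_integral_eq_lintegral_ofReal,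
        polynomialEnsembleDensity_expConvolution hneg hf hy, ENNReal.ofReal_mul
          (mul_pos (vdm_pos hy) (Real.exp_pos _)).le]
      · simp only [a]
        ring
      · exact (integral_interlaces hf hy).1.const_mul _
      · exact (ae_restrict_mem (hIy y)).mono fun x hx =>
          tiltedDet_nonneg h0 (Interlaces.strictMono_left hx)
    · rw [Set.indicator_of_notMem (by exact hy)]
      have : ∀ x, K x y = 0 := fun x =>
        Set.indicator_of_notMem (s := I) (a := (x, y))
          (fun h => hy (Interlaces.strictMono_right h)) _
      simp [this]
  rw [lintegral_congr hleft, lintegral_congr hright]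
  exact lintegral_lintegral_swap hK

end

/-- The symmetric statistics of the squared singular values after appending a Gaussian row. -/
lemma lintegral_sqSingularValues_appendRow {Ω : Type*} [MeasurableSpace Ω] {P : Measure Ω}
    [IsProbabilityMeasure P] {m n : ℕ} {X : Ω → Matrix (Fin m) (Fin n) ℂ}
    (hX : ∀ i j, AEMeasurable (fun ω => X ω i j) P) {v : Ω → Fin n → ℂ}
    (hv : IsStandardComplexGaussianVector P v) (hXv : IndepFun (fun ω i j => X ω i j) v P)
    {F : (Fin n → ℝ) → ℝ≥0∞} (hF : Measurable F) :
    ∫⁻ ω, F (sqSingularValues (appendRow (X ω) (v ω))) ∂P =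
      ∫⁻ ω, perturbedExpectation F (sqSingularValues (X ω)) ∂P := by
  obtain ⟨hvm, hvlaw⟩ := hv.aemeasurable_and_map_eq
  let X' : Ω → Fin m → Fin n → ℂ := fun ω i j => X ω i j
  have hXm : AEMeasurable X' P := aemeasurable_pi_iff.2 fun i => aemeasurable_pi_iff.2 fun j => hX i j
  have hpair : P.map (fun ω => (X' ω, v ω)) = (P.map X').prod (complexGaussian n) := by
    rw [← hvlaw]
    exact (indepFun_iff_map_prod_eq_prod_map_map hXm hvm).1 hXv
  have hS : Measurable fun A : Fin m → Fin n → ℂ => sqSingularValues (Matrix.of A) :=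
    measurable_sqSingularValues (F := fun A : Fin m → Fin n → ℂ => Matrix.of A) fun i j =>
      (measurable_pi_apply j).comp (measurable_pi_apply i)
  have hG : Measurable fun p : (Fin m → Fin n → ℂ) × (Fin n → ℂ) =>
      F (sqSingularValues (appendRow (Matrix.of p.1) p.2)) := by
    refine hF.comp (measurable_sqSingularValues
      (F := fun p : (Fin m → Fin n → ℂ) × (Fin n → ℂ) => appendRow (Matrix.of p.1) p.2) ?_)
    rintro (i | i) j
    · exact (measurable_pi_apply j).comp ((measurable_pi_apply i).comp measurable_fst)
    · have : Measurable fun p : (Fin m → Fin n → ℂ) × (Fin n → ℂ) => star (p.2 j) :=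
        Complex.continuous_conj.measurable.comp ((measurable_pi_apply j).comp measurable_snd)
      exact this
  calc ∫⁻ ω, F (sqSingularValues (appendRow (X ω) (v ω))) ∂P
      = ∫⁻ p, F (sqSingularValues (appendRow (Matrix.of p.1) p.2))
          ∂(P.map fun ω => (X' ω, v ω)) :=
        (lintegral_map' hG.aemeasurable (hXm.prodMk hvm)).symm
    _ = ∫⁻ A, ∫⁻ w, F (sqSingularValues (appendRow (Matrix.of A) w)) ∂complexGaussian n
          ∂(P.map X') := by
        rw [hpair, lintegral_prod _ hG.aemeasurable]
    _ = ∫⁻ A, perturbedExpectation F (sqSingularValues (Matrix.of A)) ∂(P.map X') := by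
        refine lintegral_congr fun A => ?_
        simp only [sqSingularValues_appendRow]
        -- With the matrix fixed, its eigenvector unitary is a constant and is absorbed by the
        -- Gaussian law.
        refine lintegral_comp_mulVec hF _ ?_
        rw [star_star]
        exact Unitary.coe_star_mul_self _
    _ = ∫⁻ ω, perturbedExpectation F (sqSingularValues (X ω)) ∂P :=
        lintegral_map' ((measurable_perturbedExpectation hF).comp hS).aemeasurable hXm

theorem corollary5p3 {Ω : Type*} [MeasurableSpace Ω] (P : Measure Ω) [IsProbabilityMeasure P]
    (n ν : ℕ) (f : Fin n → ℝ → ℝ)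
    -- the functions live on `[0, ∞)` and are extended by zero
    (hf : ∀ k x, x < 0 → f k x = 0)
    (X : Ω → Matrix (Fin (n + ν)) (Fin n) ℂ) (hX : ∀ i j, AEMeasurable (fun ω => X ω i j) P)
    (hXf : IsPolynomialEnsemble (unorderedLaw P fun ω => sqSingularValues (X ω)) f)
    (v : Ω → Fin n → ℂ) (hv : IsStandardComplexGaussianVector P v)
    (hXv : IndepFun (fun ω i j => X ω i j) v P) :
    IsPolynomialEnsemble (unorderedLaw P fun ω => sqSingularValues (appendRow (X ω) (v ω)))
      (fun k y => ∫ x in (0 : ℝ)..y, Real.exp (-x) * f k (y - x)) := by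
  obtain ⟨-, hmom, Z, hZ, h0, hlaw⟩ := hXf
  have hint : ∀ k, Integrable (f k) := fun k => by
    simpa using hmom ⟨0, k.pos⟩ k
  have hmomg : ∀ j k : Fin n, Integrable fun y => y ^ (j : ℕ) * expConvolution (f k) y :=
    fun j k => integrable_pow_mul_expConvolution (hf k) j fun i hi =>
      hmom ⟨i, hi.trans_lt j.2⟩ k
  have hintg : ∀ k, Integrable (expConvolution (f k)) := fun k => by
    simpa using hmomg ⟨0, k.pos⟩ k
  have hvm := hv.aemeasurable_and_map_eq.1
  have hXS : AEMeasurable (fun ω => sqSingularValues (X ω)) P := by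
    have hXm : AEMeasurable (fun ω i j => X ω i j) P :=
      aemeasurable_pi_iff.2 fun i => aemeasurable_pi_iff.2 fun j => hX i j
    have hS : Measurable fun A : Fin (n + ν) → Fin n → ℂ => sqSingularValues (Matrix.of A) :=
      measurable_sqSingularValues (F := fun A : Fin (n + ν) → Fin n → ℂ => Matrix.of A)
        fun i j => (measurable_pi_apply j).comp (measurable_pi_apply i)
    exact hS.comp_aemeasurable hXm
  have hYS : AEMeasurable (fun ω => sqSingularValues (appendRow (X ω) (v ω))) P := by
    have hYm : AEMeasurable (fun ω i j => appendRow (X ω) (v ω) i j) P := by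
      refine aemeasurable_pi_iff.2 fun i => aemeasurable_pi_iff.2 fun j => ?_
      rcases i with i | i
      · exact hX i j
      · exact Complex.continuous_conj.measurable.comp_aemeasurable (aemeasurable_pi_iff.1 hvm j)
    have hS : Measurable fun A : Fin (n + ν) ⊕ Unit → Fin n → ℂ => sqSingularValues (Matrix.of A) :=
      measurable_sqSingularValues (F := fun A : Fin (n + ν) ⊕ Unit → Fin n → ℂ => Matrix.of A)
        fun i j => (measurable_pi_apply j).comp (measurable_pi_apply i)
    exact hS.comp_aemeasurable hYm
  have hD : AEMeasurable fun y => ENNReal.ofReal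
      (polynomialEnsembleDensity (fun k => expConvolution (f k)) Z y) :=
    (aemeasurable_polynomialEnsembleDensity fun k => (hintg k).1.aemeasurable).ennreal_ofReal
  have hDf : AEMeasurable fun y => ENNReal.ofReal (polynomialEnsembleDensity f Z y) :=
    (aemeasurable_polynomialEnsembleDensity fun k => (hint k).1.aemeasurable).ennreal_ofReal
  refine ⟨⟨?_⟩, hmomg, Z, hZ,
    polynomialEnsembleDensity_expConvolution_nonneg hf hint h0, ?_⟩
  -- Total mass is computed from the unordered law itself, so no separate evaluation of the
  -- normalizing constant is needed.
  · rw [← lintegral_one, lintegral_unorderedLaw hYS measurable_const,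
      symmetrize_eq_self fun _ _ => rfl, lintegral_one, measure_univ]
  · refine Measure.ext_of_lintegral _ fun h hm => ?_
    have hsm := measurable_symmetrize hm
    have hss := symmetrize_comp_perm h
    calc ∫⁻ y, h y ∂(unorderedLaw P fun ω => sqSingularValues (appendRow (X ω) (v ω)))
        = ∫⁻ ω, symmetrize h (sqSingularValues (appendRow (X ω) (v ω))) ∂P :=
          lintegral_unorderedLaw hYS hm
      _ = ∫⁻ ω, perturbedExpectation (symmetrize h) (sqSingularValues (X ω)) ∂P :=
          lintegral_sqSingularValues_appendRow hX hv hXv hsm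
      _ = ∫⁻ x, perturbedExpectation (symmetrize h) x
            ∂(unorderedLaw P fun ω => sqSingularValues (X ω)) := by
          rw [lintegral_unorderedLaw hXS (measurable_perturbedExpectation hsm),
            symmetrize_eq_self fun σ x => perturbedExpectation_comp_perm hsm σ x]
      _ = ∫⁻ x, perturbedExpectation (symmetrize h) x *
            ENNReal.ofReal (polynomialEnsembleDensity f Z x) := by
          rw [hlaw, lintegral_withDensity_eq_lintegral_mul₀ hDf
            (measurable_perturbedExpectation hsm).aemeasurable]
          exact lintegral_congr fun x => mul_comm _ _
      _ = ∫⁻ y, symmetrize h y * ENNReal.ofReal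
            (polynomialEnsembleDensity (fun k => expConvolution (f k)) Z y) :=
          lintegral_perturbedExpectation_mul hf hint h0 hsm hss
      _ = ∫⁻ y, h y * ENNReal.ofReal
            (polynomialEnsembleDensity (fun k => expConvolution (f k)) Z y) :=
          lintegral_symmetrize_mul hm hD fun σ x => by rw [polynomialEnsembleDensity_comp_perm]
      _ = ∫⁻ y, h y ∂(volume.withDensity fun y => ENNReal.ofReal
            (polynomialEnsembleDensity (fun k => expConvolution (f k)) Z y)) := by
          rw [lintegral_withDensity_eq_lintegral_mul₀ hD hm.aemeasurable]
          exact lintegral_congr fun x => mul_comm _ _
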